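/- **Setting.** Let $S$ be a finite set, $A=\mathbb R^d$ with Lebesgue measure $\lambda$, $P(ds'\mid s,a)$ a probability kernel from $S\times A$ to $S$, $c:S\times A\to\mathbb R$ bounded and measurable, $\gamma\in[0,1)$ and $\tau>0$. Let $U:\mathbb R^d\to\mathbb R$ be differentiable and such that $\mu(da)=e^{-U(a)}\lambda(da)$ is a probability measure. For a (possibly history-dependent) policy $\pi=(\pi_n)_{n\ge 0}$, where $\pi_n$ is a probability kernel from the histories $h_n=(s_0,a_0,\dots,s_{n-1},a_{n-1},s_n)$ to $A$, put $$V^\pi(s)=\mathbb E^\pi_s\Big[\sum_{n\ge 0}\gamma^n\big(c(s_n,a_n)+\tau\,\mathrm{KL}(\pi_n(\cdot\mid h_n)\mid\mu)\big)\Big]\in\mathbb R\cup\{\infty\},\qquad V^\pi(\rho)=\int_S V^\pi\,d\rho .$$ A policy $\pi^*$ is optimal if $V^{\pi^*}(s)=\inf_\pi V^\pi(s)$ for all $s\in S$, the infimum being over all history-dependent policies. For stationary Markov $\pi$ let $Q^\pi(s,a)=c(s,a)+\gamma\int_S V^\pi(s')P(ds'\mid s,a)$, let $P_\pi(ds'\mid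 s)=\int_A P(ds'\mid s,a)\pi(da\mid s)$, let $d^\pi_\rho=(1-\gamma)\sum_{n\ge0}\gamma^n\rho P_\pi^n$, and let $\Phi[\pi](\cdot\mid s)$ be the minimiser of $m\mapsto\int_A Q^\pi(s,a)\,m(da)+\tau\,\mathrm{KL}(m\mid\mu)$ over the probability measures $m$ on $A$. Let $\Pi_\mu$ be the set of stationary policies $\pi(da\mid s)=e^{f(s,a)}\mu(da)/\int e^{f(s,a')}\mu(da')$ with $f$ bounded and measurable. **Log-Sobolev inequality.** A probability measure $m$ on $\mathbb R^d$ satisfies the log-Sobolev inequality with constant $\alpha>0$ if $\mathrm{KL}(\nu\mid m)\le\frac1{2\alpha}\int|\nabla\ln\frac{d\nu}{dm}|^2d\nu$ for every probability measure $\nu$ that has a positive $C^1$ density with respect to $m$. **Regular solution.** Stationary policies $(\pi_t)_{t\ge0}$ with Lebesgue densities $p_t(s,a)$ are a regular solution of the Wasserstein gradient flow if, for each $s\in S$: 1. $\pi_t\in\Pi_\mu$ for all $t\ge0$, where for each $T$ the corresponding $f=f_t$, $t\in[0,T]$, can be chosen bounded by a constant depending only on $T$; 2. $(a,t)\mapsto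 p_t(s,a)$ is of class $C^{2,1}$ on $\mathbb R^d\times(0,\infty)$, and for all $0<t_0\le t_1$ there are $K,\delta>0$ with $|p_t(s,a)|+|\partial_tp_t(s,a)|+|\nabla_ap_t(s,a)|\le Ke^{-\delta|a|^2}$ for all $a$ and all $t\in[t_0,t_1]$; 3. for $t>0$, $Q^{\pi_t}(s,\cdot)$ and $p_t\nabla_aQ^{\pi_t}+\tau p_t\nabla U$ are differentiable in $a$, and $$\partial_tp_t=\nabla_a\cdot\big(p_t\nabla_aQ^{\pi_t}+\tau p_t\nabla U\big)+\tau\Delta_ap_t ;$$ 4. $p_t(s,\cdot)\to p_0(s,\cdot)$ in $L^1(\lambda)$ as $t\downarrow0$. **Theorem.** Suppose that $\mu$ satisfies a log-Sobolev inequality with some positive constant, and let $(\pi_t)_{t\ge0}$ be a regular solution. Then there is $\alpha>0$ such that $$\mathrm{KL}(\pi_t\mid\Phi[\pi_t])(s)\le\frac1{2\alpha}\int_A\Big|\nabla_a\ln\frac{d\pi_t}{d\Phi[\pi_t]}\Big|^2\pi_t(da\mid s)\qquad\text{for all }t>0,\ s\in S, \tag{1}$$ and such that, for every probability measure $\rho$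 on $S$, every optimal stationary Markov policy $\pi^*$ and every $t\ge0$, $$0\le V^{\pi_t}(\rho)-V^{\pi^*}(\rho)\le\bar\kappa\Big(\int_S\big(V^{\pi_0}(s)-V^{\pi^*}(s)\big)\,d^{\pi^*}_\rho(ds)\Big)e^{-2\underline\kappa\,\alpha\tau t}, \tag{2}$$ where $\bar\kappa$ and $\underline\kappa$ are the essential supremum and infimum with respect to $d^{\pi^*}_\rho$ of $\frac{d\rho}{d d^{\pi^*}_\rho}$ (that is, the supremum and infimum over the states charged by $d^{\pi^*}_\rho$). Moreover, for every $\alpha>0$ for which (1) holds, (2) holds with $(1-\gamma)\alpha$ in place of $\alpha$ in the exponent. -/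

import Mathlib

open MeasureTheory ProbabilityTheory InformationTheory Filter Topology
open scoped ENNReal

/-! ### Entropy-regularised Markov decision processes -/

/-- An infinite horizon Markov decision model `(S, A, P, c, γ)` with bounded measurable cost. -/
structure MDP (S A : Type*) [MeasurableSpace S] [MeasurableSpace A] where
  /-- the transition probability `P(ds' | s, a)` -/
  P : Kernel (S × A) S
  markov : IsMarkovKernel P
  /-- the cost function -/
  c : S × A → ℝ
  measurable_c : Measurable c
  bounded_c : ∃ C : ℝ, ∀ x, |c x| ≤ C
  /-- the discount factor -/
  γ : ℝ
  γ_nonneg : 0 ≤ γ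
  γ_lt_one : γ < 1

/-- The space `H_n = (S × A)^n × S` of admissible histories at time `n`. -/
abbrev History (S A : Type*) (n : ℕ) : Type _ := (Fin n → S × A) × S

/-- A (possibly non-Markovian) stochastic policy: for each `n` a probability kernel from the
histories at time `n` to the actions. -/
structure Policy (S A : Type*) [MeasurableSpace S] [MeasurableSpace A] where
  kernel : ∀ n : ℕ, Kernel (History S A n) A
  markov : ∀ n, IsMarkovKernel (kernel n)

/-- A stationary Markov policy, seen as a policy: `π_n(· | h_n) = π(· | s_n)` for all `n`. -/
noncomputable def Policy.ofKernel {S A : Type*} [MeasurableSpace S] [MeasurableSpace A]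
    (π : Kernel S A) [IsMarkovKernel π] : Policy S A where
  kernel n := π.comap (fun h : History S A n => h.2) measurable_snd
  markov _ := inferInstance

namespace MDP

section General

variable {S A : Type*} [MeasurableSpace S] [MeasurableSpace A]

instance (M : MDP S A) : IsMarkovKernel M.P := M.markov

instance (π : Policy S A) (n : ℕ) : IsMarkovKernel (π.kernel n) := π.markov n

/-- The history at time `n + 1` made of `(s_0, a_0), …, (s_n, a_n)` and of the new state. -/
def extendHistory (n : ℕ) (x : ((_ : Finset.Iic n) → S × A) × S) : History S A (n + 1) :=
  (fun i : Fin (n + 1) => x.1 ⟨i, Finset.mem_Iic.2 (Nat.lt_succ_iff.1 i.2)⟩, x.2)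

lemma measurable_extendHistory (n : ℕ) :
    Measurable (extendHistory n : ((_ : Finset.Iic n) → S × A) × S → History S A (n + 1)) := by
  unfold extendHistory
  fun_prop

/-- The law of `(s_{n+1}, a_{n+1})` given `(s_0, a_0, …, s_n, a_n)`: first
`s_{n+1} ∼ P(· | s_n, a_n)`, then `a_{n+1} ∼ π_{n+1}(· | h_{n+1})`. -/
noncomputable def stepKernel (M : MDP S A) (π : Policy S A) (n : ℕ) :
    Kernel ((_ : Finset.Iic n) → S × A) (S × A) :=
  (M.P.comap (fun x : (_ : Finset.Iic n) → S × A => x ⟨n, Finset.mem_Iic.2 le_rfl⟩)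
      (measurable_pi_apply _)) ⊗ₖ
    ((π.kernel (n + 1)).comap (extendHistory n) (measurable_extendHistory n))

instance (M : MDP S A) (π : Policy S A) (n : ℕ) : IsMarkovKernel (M.stepKernel π n) := by
  unfold stepKernel; infer_instance

/-- The law of `(s_0, a_0)`: `s_0 ∼ ρ`, then `a_0 ∼ π_0(· | s_0)`. -/
noncomputable def initialLaw (π : Policy S A) (ρ : Measure S) : Measure (S × A) :=
  ρ ⊗ₘ ((π.kernel 0).comap (fun s : S => ((Fin.elim0 : Fin 0 → S × A), s))
    measurable_prodMk_left)

/-- The law `ℙ^π_ρ` of `(s_0, a_0, s_1, a_1, …)` on the canonical space `(S × A)^ℕ`. -/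
noncomputable def law (M : MDP S A) (π : Policy S A) (ρ : Measure S) : Measure (ℕ → S × A) :=
  Kernel.trajMeasure (X := fun _ => S × A) (initialLaw π ρ) (M.stepKernel π)

/-- The history `h_n = (s_0, a_0, …, s_{n-1}, a_{n-1}, s_n)` read off a trajectory. -/
def historyAt (n : ℕ) (ω : ℕ → S × A) : History S A n :=
  (fun i : Fin n => ω i, (ω n).1)

/-- The regularised value function
`V^π(s) = 𝔼^π_s [∑ γ^n (c(s_n, a_n) + τ KL(π_n(· | h_n) | μ))]`, with values in `ℝ ∪ {∞}`.
The bounded part and the nonnegative, possibly infinite, part are integrated separately. -/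
noncomputable def valueE (M : MDP S A) (τ : ℝ) (μ : Measure A) (π : Policy S A) (s : S) : EReal :=
  ((∫ ω, ∑' n : ℕ, M.γ ^ n * M.c (ω n) ∂(M.law π (Measure.dirac s)) : ℝ) : EReal) +
    ((∫⁻ ω, ∑' n : ℕ, ENNReal.ofReal (M.γ ^ n * τ) * klDiv (π.kernel n (historyAt n ω)) μ
        ∂(M.law π (Measure.dirac s)) : ℝ≥0∞) : EReal)

/-- A policy is optimal if from every state it attains the infimum of the value functions of all
(possibly non-Markovian) policies. -/
def IsOptimal (M : MDP S A) (τ : ℝ) (μ : Measure A) (πs : Policy S A) : Prop :=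
  ∀ s, M.valueE τ μ πs s = ⨅ π : Policy S A, M.valueE τ μ π s

/-- The value function of a stationary Markov policy, as a real number
(to be used where the value is finite). -/
noncomputable def value (M : MDP S A) (τ : ℝ) (μ : Measure A) (π : Kernel S A)
    [IsMarkovKernel π] (s : S) : ℝ :=
  (M.valueE τ μ (Policy.ofKernel π) s).toReal

/-- The `Q`-function `Q^π(s, a) = c(s, a) + γ ∫ V^π(s') P(ds' | s, a)`. -/
noncomputable def Q (M : MDP S A) (τ : ℝ) (μ : Measure A) (π : Kernel S A)
    [IsMarkovKernel π] (s : S) (a : A) : ℝ :=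
  M.c (s, a) + M.γ * ∫ s', M.value τ μ π s' ∂(M.P (s, a))

/-- The state transition kernel `P_π(ds' | s) = ∫ P(ds' | s, a) π(da | s)`. -/
noncomputable def stateKernel (M : MDP S A) (π : Kernel S A) : Kernel S S :=
  M.P ∘ₖ (Kernel.id ×ₖ π)

/-- The occupancy measure `d^π_ρ = (1 - γ) ∑ γ^n ρ P_π^n`. -/
noncomputable def occupancy (M : MDP S A) (π : Kernel S A) (ρ : Measure S) : Measure S :=
  Measure.sum fun n : ℕ =>
    ENNReal.ofReal ((1 - M.γ) * M.γ ^ n) • ρ.bind ((M.stateKernel π ^ n : Kernel S S))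

/-- The essential supremum of `dρ / dd^π_ρ`; on a finite state space, the supremum of
`ρ({s}) / d^π_ρ({s})` over the states charged by `d^π_ρ`. -/
noncomputable def kappaSup (M : MDP S A) (π : Kernel S A) (ρ : Measure S) : ℝ :=
  (essSup (ρ.rnDeriv (M.occupancy π ρ)) (M.occupancy π ρ)).toReal

/-- The essential infimum of `dρ / dd^π_ρ`; on a finite state space, the infimum of
`ρ({s}) / d^π_ρ({s})` over the states charged by `d^π_ρ`. -/
noncomputable def kappaInf (M : MDP S A) (π : Kernel S A) (ρ : Measure S) : ℝ :=
  (essInf (ρ.rnDeriv (M.occupancy π ρ)) (M.occupancy π ρ)).toReal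

/-- `m` is a proximal policy `Φ[π](· | s)`: it minimises `∫ Q^π(s, a) m(da) + τ KL(m | μ)` over
all probability measures on the action space. -/
def IsProximal (M : MDP S A) (τ : ℝ) (μ : Measure A) (π : Kernel S A) [IsMarkovKernel π] (s : S)
    (m : Measure A) : Prop :=
  IsProbabilityMeasure m ∧ ∀ m' : Measure A, IsProbabilityMeasure m' →
    ((∫ a, M.Q τ μ π s a ∂m : ℝ) : EReal) + ((ENNReal.ofReal τ * klDiv m μ : ℝ≥0∞) : EReal) ≤
      ((∫ a, M.Q τ μ π s a ∂m' : ℝ) : EReal) + ((ENNReal.ofReal τ * klDiv m' μ : ℝ≥0∞) : EReal)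

/-- `π(da | s) = e^{f(s, a)} μ(da) / ∫ e^{f(s, a')} μ(da')` for some measurable `f` with
`|f| ≤ B`; the class `Π_μ` consists of the kernels that satisfy this for some `B`. -/
def InGibbsClass (μ : Measure A) (B : ℝ) (π : Kernel S A) : Prop :=
  ∃ f : S × A → ℝ, Measurable f ∧ (∀ x, |f x| ≤ B) ∧ ∀ s, π s = μ.tilted fun a => f (s, a)

end General

end MDP

/-! ### Log-Sobolev inequalities on `ℝ^d` -/

/-- The reference measure `μ(da) = e^{-U(a)} da`. -/
noncomputable def refMeasure {d : ℕ} (U : EuclideanSpace ℝ (Fin d) → ℝ) :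
    Measure (EuclideanSpace ℝ (Fin d)) :=
  volume.withDensity fun a => ENNReal.ofReal (Real.exp (-U a))

/-- `KL(ν | m) ≤ (1 / (2 α)) ∫ |∇ ln (dν/dm)|² dν`, where the density `dν/dm` is represented by a
positive continuously differentiable function `h`. -/
def LogSobolevPair {d : ℕ} (α : ℝ) (ν m : Measure (EuclideanSpace ℝ (Fin d))) : Prop :=
  ∀ h : EuclideanSpace ℝ (Fin d) → ℝ, ContDiff ℝ 1 h → (∀ a, 0 < h a) →
    ν = m.withDensity (fun a => ENNReal.ofReal (h a)) →
    klDiv ν m ≤ ENNReal.ofReal (1 / (2 * α)) *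
      ∫⁻ a, ‖gradient (fun x => Real.log (h x)) a‖ₑ ^ 2 ∂ν

/-- The log-Sobolev inequality with constant `α` for `m`: the inequality above for every
probability measure `ν` with a positive continuously differentiable density with respect to `m`. -/
def LogSobolev {d : ℕ} (α : ℝ) (m : Measure (EuclideanSpace ℝ (Fin d))) : Prop :=
  ∀ ν : Measure (EuclideanSpace ℝ (Fin d)), IsProbabilityMeasure ν → LogSobolevPair α ν m

/-! ### The Wasserstein gradient flow -/

/-- The divergence `∑ i, ∂_i F_i` of a vector field on `ℝ^d`. -/
noncomputable def vectorDiv {d : ℕ} (F : EuclideanSpace ℝ (Fin d) → EuclideanSpace ℝ (Fin d))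
    (a : EuclideanSpace ℝ (Fin d)) : ℝ :=
  ∑ i, fderiv ℝ F a (EuclideanSpace.single i 1) i

/-- The path of stationary policies `t ↦ π t`, `t ≥ 0`, with Lebesgue densities `p t s`, is a
regular solution of the Wasserstein gradient flow
`∂_t p = ∇ · (p ∇Q^{π_t} + τ p ∇U) + τ Δp` with initial value `p 0`. Only times `t ≥ 0` matter. -/
structure IsRegularFlow {S : Type*} [MeasurableSpace S] {d : ℕ}
    (M : MDP S (EuclideanSpace ℝ (Fin d))) (τ : ℝ) (U : EuclideanSpace ℝ (Fin d) → ℝ)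
    (π : ℝ → Kernel S (EuclideanSpace ℝ (Fin d))) [∀ t, IsMarkovKernel (π t)]
    (p : ℝ → S → EuclideanSpace ℝ (Fin d) → ℝ) : Prop where
  /-- `p t s` is a density of `π t s` with respect to the Lebesgue measure -/
  measurable_density : ∀ t, 0 ≤ t → ∀ s, Measurable (p t s)
  density : ∀ t, 0 ≤ t → ∀ s, π t s = volume.withDensity fun a => ENNReal.ofReal (p t s a)
  /-- `π_t ∈ Π_μ` for all `t ≥ 0`, with bounds on the log-densities that are uniform on compact
  time intervals -/
  mem_gibbs : ∀ T : ℝ, ∃ B : ℝ, ∀ t, 0 ≤ t → t ≤ T → MDP.InGibbsClass (refMeasure U) B (π t)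
  /-- `(a, t) ↦ p t s a` is of class `C^{2,1}` on `ℝ^d × (0, ∞)` -/
  contDiff_space : ∀ t, 0 < t → ∀ s, ContDiff ℝ 2 (p t s)
  continuousOn_space : ∀ s, ∀ k : ℕ, k ≤ 2 →
    ContinuousOn (fun x : ℝ × EuclideanSpace ℝ (Fin d) => iteratedFDeriv ℝ k (p x.1 s) x.2)
      (Set.Ioi 0 ×ˢ Set.univ)
  differentiable_time : ∀ t, 0 < t → ∀ s a, DifferentiableAt ℝ (fun r => p r s a) t
  continuousOn_time : ∀ s,
    ContinuousOn (fun x : ℝ × EuclideanSpace ℝ (Fin d) => deriv (fun r => p r s x.2) x.1)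
      (Set.Ioi 0 ×ˢ Set.univ)
  /-- Gaussian bounds, locally uniformly in time -/
  gaussian_bound : ∀ s, ∀ t₀ t₁ : ℝ, 0 < t₀ → ∃ K δ : ℝ, 0 < K ∧ 0 < δ ∧
    ∀ t, t₀ ≤ t → t ≤ t₁ → ∀ a,
      |p t s a| + |deriv (fun r => p r s a) t| + ‖gradient (p t s) a‖ ≤
        K * Real.exp (-(δ * ‖a‖ ^ 2))
  /-- the terms of the equation make sense classically -/
  differentiable_Q : ∀ t, 0 < t → ∀ s, Differentiable ℝ (M.Q τ (refMeasure U) (π t) s)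
  differentiable_drift : ∀ t, 0 < t → ∀ s, Differentiable ℝ fun a =>
    p t s a • gradient (M.Q τ (refMeasure U) (π t) s) a + (τ * p t s a) • gradient U a
  /-- the equation -/
  equation : ∀ t, 0 < t → ∀ s a,
    deriv (fun r => p r s a) t =
      vectorDiv (fun x => p t s x • gradient (M.Q τ (refMeasure U) (π t) s) x +
        (τ * p t s x) • gradient U x) a + τ * Laplacian.laplacian (p t s) a
  /-- the initial value is attained in `L¹` -/
  initial : ∀ s, Tendsto (fun t => ∫⁻ a, ‖p t s a - p 0 s a‖ₑ) (𝓝[>] 0) (𝓝 0)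

/-- The log-Sobolev inequality along the flow with constant `α`: for all `t > 0` and `s`,
`KL(π_t | Φ[π_t])(s) ≤ (1 / (2 α)) ∫ |∇ ln (dπ_t / dΦ[π_t])|² dπ_t(· | s)`. -/
def LogSobolevAlongFlow {S : Type*} [MeasurableSpace S] {d : ℕ}
    (M : MDP S (EuclideanSpace ℝ (Fin d))) (τ : ℝ) (μ : Measure (EuclideanSpace ℝ (Fin d)))
    (π : ℝ → Kernel S (EuclideanSpace ℝ (Fin d))) [∀ t, IsMarkovKernel (π t)] (α : ℝ) : Prop :=
  ∀ t, 0 < t → ∀ s, ∀ m, M.IsProximal τ μ (π t) s m → LogSobolevPair α (π t s) m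

/-!
Exponential convergence of the Wasserstein gradient flow of an entropy-regularised Markov decision
process with finitely many states.

Write `v_t` for the value of `π_t`, `Q_t` for its `Q`-function, `Φ_t ∝ e^{-Q_t/τ} μ` for the
proximal policy and `ψ = Q_t + τ ln (dπ_t/dμ)`, which is `τ ln (dπ_t/dΦ_t)` up to a constant. The
flux of the equation is `p ∇ψ`.

*Dissipation.* Freeze the continuation value at `v_t`. The expected cost
`∫ Q_t dπ_r + τ KL(π_r | μ)` of the decision at `s` then has derivative `-D(s) = ∫ ψ ∂_t p` at
`r = t` (`IsRegularFlow.hasDerivAt_frozen`), and integration by parts gives `D ≥ ∫ |∇ψ|² dπ_t`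
(`lintegral_norm_gradient_sq_le`). Nothing is known about the growth of `∇Q` and `∇U`, but `ψ` is
bounded, so the boundary terms of a cutoff argument can be absorbed into the Dirichlet integral;
and the divergence theorem is used in the form that asks only the divergence to be integrable.
The log-Sobolev inequality for `Φ_t` yields `D ≥ 2 α τ² KL(π_t | Φ_t)`
(`IsRegularFlow.klDiv_proximal_le`). Differentiating the Bellman equation `v = g + γ P v` gives
`(1 - γ P) v' = -D`, and since `(1 - γ P)⁻¹ ≥ 1` it follows that `v' ≤ -D`
(`IsRegularFlow.exists_hasDerivAt_value`).

*Comparison with the optimum.* For an optimal `π*`, the Gibbs variational identity gives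
`(1 - γ P*)(v_t - v*) ≤ τ KL(π_t | Φ_t)` (`MDP.value_sub_le`). The occupancy measure `d` of `π*`
satisfies `d (1 - γ P*) = (1 - γ) ρ`, hence
`d/dt ∫ (v_t - v*) dd ≤ -2 α τ (1 - γ) ∫ (v_t - v*) dρ ≤ -2 α τ (1 - γ) κ_inf ∫ (v_t - v*) dd`,
and Grönwall's inequality applies on `(0, ∞)` (`IsRegularFlow.integral_gap_le`). At `t = 0` the
values are continuous because the densities converge in `L¹` and the log-densities are bounded
(`IsRegularFlow.tendsto_value_zero`).

*The log-Sobolev constant.* The values decrease along the flow and are bounded below, so `Q_t` is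
bounded uniformly in time and the Holley-Stroock principle (`LogSobolev.withDensity`) transfers the
log-Sobolev inequality of `μ` to all `Φ_t` with one constant
(`IsRegularFlow.exists_logSobolevAlongFlow`).
-/

/-! ### The law of a stationary policy -/

namespace MDP
section StationaryLaw

variable {S A : Type*} [MeasurableSpace S] [MeasurableSpace A]

instance (M : MDP S A) (π : Kernel S A) [IsMarkovKernel π] : IsMarkovKernel (M.stateKernel π) := by
  unfold stateKernel; infer_instance

lemma isMarkovKernel_pow (κ : Kernel S S) [IsMarkovKernel κ] (n : ℕ) : IsMarkovKernel (κ ^ n) := by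
  induction n with
  | zero => exact inferInstanceAs (IsMarkovKernel (Kernel.id : Kernel S S))
  | succ n ih => rw [pow_succ]; exact inferInstanceAs (IsMarkovKernel ((κ ^ n) ∘ₖ κ))

lemma lintegral_stateKernel (M : MDP S A) (π : Kernel S A) [IsMarkovKernel π] (s : S)
    {k : S → ℝ≥0∞} (hk : Measurable k) :
    ∫⁻ s', k s' ∂(M.stateKernel π s) = ∫⁻ a, ∫⁻ s', k s' ∂(M.P (s, a)) ∂(π s) := by
  unfold stateKernel
  rw [Kernel.lintegral_comp _ _ _ hk, Kernel.lintegral_prod _ _ _ (by fun_prop)]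
  rw [Kernel.id_apply, lintegral_dirac' _ (by fun_prop)]

instance (π : Policy S A) (ρ : Measure S) [IsProbabilityMeasure ρ] :
    IsProbabilityMeasure (initialLaw π ρ) := by
  unfold initialLaw; infer_instance

instance (M : MDP S A) (π : Policy S A) (ρ : Measure S) [IsProbabilityMeasure ρ] :
    IsProbabilityMeasure (M.law π ρ) := by
  unfold law; infer_instance

lemma law_map_eval_zero (M : MDP S A) (π : Policy S A) (ρ : Measure S) [IsProbabilityMeasure ρ] :
    (M.law π ρ).map (fun ω => ω 0) = initialLaw π ρ := by
  have h : (M.law π ρ).map (Preorder.frestrictLe (π := fun _ : ℕ => S × A) 0) = (initialLaw π ρ).map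
      (MeasurableEquiv.piUnique (fun _ : Finset.Iic 0 => S × A)).symm := by
    unfold law Kernel.trajMeasure
    rw [Measure.map_comp _ _ (by fun_prop), Kernel.traj_map_frestrictLe, Kernel.partialTraj_self,
      Measure.id_comp]
  have h2 : (fun ω : ℕ → S × A => ω 0) =
      (MeasurableEquiv.piUnique (fun _ : Finset.Iic 0 => S × A)) ∘
        (Preorder.frestrictLe (π := fun _ : ℕ => S × A) 0) := by
    rfl
  rw [h2, ← Measure.map_map (by fun_prop) (by fun_prop), h, Measure.map_map (by fun_prop) (by fun_prop),
    MeasurableEquiv.self_comp_symm, Measure.map_id]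

lemma law_map_eval (M : MDP S A) (π : Kernel S A) [IsMarkovKernel π] (ρ : Measure S)
    [IsProbabilityMeasure ρ] (n : ℕ) :
    (M.law (Policy.ofKernel π) ρ).map (fun ω => ω n) =
      (ρ.bind ((M.stateKernel π ^ n : Kernel S S))) ⊗ₘ π := by
  induction n with
  | zero =>
    rw [law_map_eval_zero]
    have : ρ.bind ((M.stateKernel π ^ 0 : Kernel S S)) = ρ := Measure.id_comp
    rw [this]
    rfl
  | succ n ih =>
    have := isMarkovKernel_pow (M.stateKernel π) n
    have := isMarkovKernel_pow (M.stateKernel π) (n + 1)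
    have h := Kernel.map_frestrictLe_trajMeasure_compProd_eq_map_trajMeasure
      (X := fun _ => S × A) (μ₀ := initialLaw (Policy.ofKernel π) ρ)
      (κ := M.stepKernel (Policy.ofKernel π)) (a := n)
    have h2 := congrArg Measure.snd h
    rw [Measure.snd_compProd, Measure.snd_map_prodMk (by fun_prop)] at h2
    change (M.law (Policy.ofKernel π) ρ).map (fun ω => ω (n + 1)) = _
    unfold law at ih ⊢
    rw [← h2]
    ext B hB
    rw [Measure.bind_apply hB (Kernel.aemeasurable _),
      lintegral_map (Kernel.measurable_coe _ hB) (by fun_prop), Measure.compProd_apply hB]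
    have hk : Measurable fun s' => π s' (Prod.mk s' ⁻¹' B) :=
      Kernel.measurable_kernel_prodMk_left hB
    have hz : Measurable fun z : S × A => ∫⁻ s', π s' (Prod.mk s' ⁻¹' B) ∂(M.P z) :=
      hk.lintegral_kernel
    have h3 : ∀ ω : ℕ → S × A, M.stepKernel (Policy.ofKernel π) n
        (Preorder.frestrictLe (π := fun _ : ℕ => S × A) n ω) B =
        ∫⁻ s', π s' (Prod.mk s' ⁻¹' B) ∂(M.P (ω n)) := by
      intro ω
      unfold stepKernel
      rw [Kernel.compProd_apply hB]
      rfl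
    have h4 : ∫⁻ s', π s' (Prod.mk s' ⁻¹' B)
        ∂(ρ.bind ((M.stateKernel π ^ (n + 1) : Kernel S S))) =
        ∫⁻ s, ∫⁻ s', π s' (Prod.mk s' ⁻¹' B) ∂(M.stateKernel π s)
          ∂(ρ.bind ((M.stateKernel π ^ n : Kernel S S))) := by
      rw [pow_succ', show M.stateKernel π * M.stateKernel π ^ n =
        M.stateKernel π ∘ₖ (M.stateKernel π ^ n) from rfl, ← Measure.comp_assoc,
        Measure.lintegral_bind (Kernel.aemeasurable _) hk.aemeasurable]
    simp_rw [h3]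
    rw [← lintegral_map (μ := Kernel.trajMeasure _ _) (g := fun ω : ℕ → S × A => ω n) hz
      (by fun_prop), ih, Measure.lintegral_compProd hz,
      h4]
    simp_rw [lintegral_stateKernel M π _ hk]

end StationaryLaw
end MDP

/-! ### The Bellman equation -/

namespace MDP

lemma abs_integral_le_of_bound {X : Type*} [MeasurableSpace X] (m : Measure X)
    [IsProbabilityMeasure m] {f : X → ℝ} {C : ℝ} (hf : ∀ x, |f x| ≤ C) : |∫ x, f x ∂m| ≤ C := by
  have := norm_integral_le_of_norm_le_const (μ := m) (f := f) (C := C) (ae_of_all _ hf)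
  simpa using this

lemma exists_abs_le_of_fintype {ι : Type*} [Fintype ι] (f : ι → ℝ) : ∃ C : ℝ, ∀ i, |f i| ≤ C :=
  ⟨∑ i, |f i|, fun i => Finset.single_le_sum (f := fun i => |f i|) (fun _ _ => abs_nonneg _)
    (Finset.mem_univ i)⟩

section Bounds

variable {S A : Type*} [MeasurableSpace S] [MeasurableSpace A]

lemma integrable_cost (M : MDP S A) (m : Measure A) [IsFiniteMeasure m] (s : S) :
    Integrable (fun a => M.c (s, a)) m := by
  obtain ⟨C, hC⟩ := M.bounded_c
  exact Integrable.of_bound (C := C) (M.measurable_c.comp measurable_prodMk_left).aestronglyMeasurable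
    (ae_of_all _ fun a => hC _)

lemma summable_discounted (M : MDP S A) {u : ℕ → ℝ} {C : ℝ} (hu : ∀ n, |u n| ≤ C) :
    Summable fun n => M.γ ^ n * u n := by
  refine Summable.of_norm_bounded (g := fun n => M.γ ^ n * C)
    ((summable_geometric_of_lt_one M.γ_nonneg M.γ_lt_one).mul_right C) fun n => ?_
  rw [Real.norm_eq_abs, abs_mul, abs_of_nonneg (pow_nonneg M.γ_nonneg n)]
  exact mul_le_mul_of_nonneg_left (hu n) (pow_nonneg M.γ_nonneg n)

lemma abs_Q_le (M : MDP S A) (τ : ℝ) (μ : Measure A) (π : Kernel S A) [IsMarkovKernel π]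
    {C K : ℝ} (hC : ∀ x, |M.c x| ≤ C) (hK : ∀ s, |M.value τ μ π s| ≤ K) (s : S) (a : A) :
    |M.Q τ μ π s a| ≤ C + M.γ * K := by
  refine (abs_add_le _ _).trans (add_le_add (hC _) ?_)
  rw [abs_mul, abs_of_nonneg M.γ_nonneg]
  exact mul_le_mul_of_nonneg_left (abs_integral_le_of_bound _ hK) M.γ_nonneg

lemma integral_law_cost (M : MDP S A) (π : Kernel S A) [IsMarkovKernel π] (s : S) :
    ∫ ω, ∑' n : ℕ, M.γ ^ n * M.c (ω n) ∂(M.law (Policy.ofKernel π) (Measure.dirac s)) =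
      ∑' n : ℕ, M.γ ^ n * ∫ x, ∫ a, M.c (x, a) ∂(π x) ∂((M.stateKernel π ^ n) s) := by
  obtain ⟨C, hC⟩ := M.bounded_c
  have hterm : ∀ n : ℕ, Integrable (fun ω : ℕ → S × A => M.γ ^ n * M.c (ω n))
      (M.law (Policy.ofKernel π) (Measure.dirac s)) := fun n =>
    (Integrable.of_bound (C := C)
      (M.measurable_c.comp (measurable_pi_apply n)).aestronglyMeasurable
      (ae_of_all _ fun a => hC _)).const_mul _
  rw [← (hasSum_integral_of_summable_integral_norm hterm ?_).tsum_eq]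
  · congr 1 with n
    have := isMarkovKernel_pow (M.stateKernel π) n
    rw [integral_const_mul, ← integral_map (φ := fun ω : ℕ → S × A => ω n)
      (measurable_pi_apply n).aemeasurable
      M.measurable_c.aestronglyMeasurable, law_map_eval,
      Measure.dirac_bind (Kernel.measurable _), Measure.integral_compProd]
    exact Integrable.of_bound (C := C) M.measurable_c.aestronglyMeasurable (ae_of_all _ fun a => hC _)
  · simp_rw [norm_mul, Real.norm_eq_abs, abs_of_nonneg (pow_nonneg M.γ_nonneg _),
      integral_const_mul]
    refine M.summable_discounted (C := C) fun n => abs_integral_le_of_bound _ fun ω => ?_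
    rw [abs_abs]
    exact hC _

end Bounds

section Bellman

variable {S A : Type*} [Fintype S] [MeasurableSpace S] [MeasurableSingletonClass S]
  [MeasurableSpace A]

/-- The expected regularised one-step cost `∫ c(s, a) π(da | s) + τ KL(π(· | s) | μ)` of a
stationary policy; the relative entropy is read as `0` where it is infinite. -/
noncomputable def stageCost (M : MDP S A) (τ : ℝ) (μ : Measure A) (π : Kernel S A) (s : S) : ℝ :=
  ∫ a, M.c (s, a) ∂(π s) + τ * (klDiv (π s) μ).toReal

lemma integral_stateKernel (M : MDP S A) (π : Kernel S A) [IsMarkovKernel π] (s : S) (f : S → ℝ) :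
    ∫ s', f s' ∂(M.stateKernel π s) = ∫ a, ∫ s', f s' ∂(M.P (s, a)) ∂(π s) := by
  have h : (Kernel.id ×ₖ π) s = (π s).map (Prod.mk s) := by
    rw [Kernel.prod_apply, Kernel.id_apply, Measure.dirac_prod]
  have hf : StronglyMeasurable f := (measurable_of_finite f).stronglyMeasurable
  rw [show M.stateKernel π s = (M.P ∘ₖ (Kernel.id ×ₖ π)) s from rfl,
    Kernel.integral_comp (Integrable.of_finite), h,
    integral_map (by fun_prop) (hf.integral_kernel).aestronglyMeasurable]

/-- Integrals of functions on a finite discrete space with respect to `κ ^ (n + 1)`, one step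
being split off at the start. -/
lemma integral_pow_succ (κ : Kernel S S) [IsMarkovKernel κ] (n : ℕ) (s : S) (f : S → ℝ) :
    ∫ x, f x ∂((κ ^ (n + 1)) s) = ∫ y, ∫ x, f x ∂((κ ^ n) y) ∂(κ s) := by
  have := isMarkovKernel_pow κ n
  rw [pow_succ]
  exact Kernel.integral_comp (κ := κ) (η := κ ^ n) Integrable.of_finite

lemma lintegral_law_klDiv (M : MDP S A) (τ : ℝ) (μ : Measure A) (π : Kernel S A)
    [IsMarkovKernel π] (s : S) :
    ∫⁻ ω, ∑' n : ℕ, ENNReal.ofReal (M.γ ^ n * τ) *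
        klDiv ((Policy.ofKernel π).kernel n (historyAt n ω)) μ
        ∂(M.law (Policy.ofKernel π) (Measure.dirac s)) =
      ∑' n : ℕ, ENNReal.ofReal (M.γ ^ n * τ) *
        ∫⁻ x, klDiv (π x) μ ∂((M.stateKernel π ^ n) s) := by
  have hk : Measurable fun x : S => klDiv (π x) μ := measurable_of_finite _
  have hω : ∀ (n : ℕ) (ω : ℕ → S × A),
      klDiv ((Policy.ofKernel π).kernel n (historyAt n ω)) μ = klDiv (π (ω n).1) μ :=
    fun n ω => rfl
  simp_rw [hω]
  have hk' : Measurable fun z : S × A => klDiv (π z.1) μ := hk.comp measurable_fst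
  have hkn : ∀ n, Measurable fun ω : ℕ → S × A => klDiv (π (ω n).1) μ := fun n =>
    hk'.comp (measurable_pi_apply n)
  rw [lintegral_tsum fun n => ((hkn n).const_mul _).aemeasurable]
  congr 1 with n
  have := isMarkovKernel_pow (M.stateKernel π) n
  rw [lintegral_const_mul _ (hkn n),
    ← lintegral_map (g := fun ω : ℕ → S × A => ω n) (f := fun z : S × A => klDiv (π z.1) μ)
      hk' (measurable_pi_apply n), law_map_eval,
    Measure.dirac_bind (Kernel.measurable _), Measure.lintegral_compProd hk']
  simp

/-- If a stationary policy has finite value at `s`, its first decision at `s` has finite relative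
entropy. -/
lemma klDiv_ne_top_of_valueE_ne_top (M : MDP S A) {τ : ℝ} (hτ : 0 < τ) (μ : Measure A)
    (π : Kernel S A) [IsMarkovKernel π] (s : S)
    (h : M.valueE τ μ (Policy.ofKernel π) s ≠ ⊤) : klDiv (π s) μ ≠ ⊤ := by
  intro htop
  apply h
  unfold valueE
  rw [lintegral_law_klDiv]
  have : ∑' n : ℕ, ENNReal.ofReal (M.γ ^ n * τ) *
      ∫⁻ x, klDiv (π x) μ ∂((M.stateKernel π ^ n) s) = ⊤ := by
    refine top_le_iff.1 (le_trans ?_ (ENNReal.le_tsum 0))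
    rw [pow_zero, pow_zero, one_mul]
    have : ∫⁻ x, klDiv (π x) μ ∂((1 : Kernel S S) s) = ⊤ := by
      rw [show (1 : Kernel S S) = Kernel.id from rfl, Kernel.id_apply, lintegral_dirac, htop]
    rw [this, ENNReal.mul_top]
    simpa using hτ
  rw [this]
  simp

section Finite

variable (M : MDP S A) {τ : ℝ} (hτ : 0 ≤ τ) (μ : Measure A) (π : Kernel S A) [IsMarkovKernel π]
  (hkl : ∀ s, klDiv (π s) μ ≠ ⊤)

include hτ hkl

lemma valueE_eq_coe (s : S) :
    M.valueE τ μ (Policy.ofKernel π) s =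
      ((∑' n : ℕ, M.γ ^ n * ∫ x, M.stageCost τ μ π x ∂((M.stateKernel π ^ n) s) : ℝ) : EReal) := by
  obtain ⟨C, hC⟩ := M.bounded_c
  obtain ⟨K, hK⟩ := exists_abs_le_of_fintype fun s => τ * (klDiv (π s) μ).toReal
  have hpow := isMarkovKernel_pow (M.stateKernel π)
  have h1 : Summable fun n => M.γ ^ n * ∫ x, ∫ a, M.c (x, a) ∂(π x) ∂((M.stateKernel π ^ n) s) :=
    M.summable_discounted (C := C) fun n =>
      abs_integral_le_of_bound _ fun x => abs_integral_le_of_bound _ fun a => hC _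
  have h2 : Summable fun n => M.γ ^ n *
      ∫ x, τ * (klDiv (π x) μ).toReal ∂((M.stateKernel π ^ n) s) :=
    M.summable_discounted fun n => abs_integral_le_of_bound _ hK
  have h0 : ∀ n, 0 ≤ M.γ ^ n * ∫ x, τ * (klDiv (π x) μ).toReal ∂((M.stateKernel π ^ n) s) :=
    fun n => mul_nonneg (pow_nonneg M.γ_nonneg n)
      (integral_nonneg fun x => mul_nonneg hτ ENNReal.toReal_nonneg)
  have h3 : ∑' n : ℕ, ENNReal.ofReal (M.γ ^ n * τ) *
      ∫⁻ x, klDiv (π x) μ ∂((M.stateKernel π ^ n) s) =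
      ENNReal.ofReal (∑' n, M.γ ^ n *
        ∫ x, τ * (klDiv (π x) μ).toReal ∂((M.stateKernel π ^ n) s)) := by
    rw [ENNReal.ofReal_tsum_of_nonneg h0 h2]
    congr 1 with n
    rw [integral_const_mul, ← mul_assoc,
      ENNReal.ofReal_mul (mul_nonneg (pow_nonneg M.γ_nonneg n) hτ),
      ofReal_integral_eq_lintegral_ofReal Integrable.of_finite
        (ae_of_all _ fun x => ENNReal.toReal_nonneg)]
    simp_rw [ENNReal.ofReal_toReal (hkl _)]
  unfold valueE
  rw [lintegral_law_klDiv, integral_law_cost, h3, EReal.coe_ennreal_ofReal,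
    max_eq_left (tsum_nonneg h0), ← EReal.coe_add, ← h1.tsum_add h2]
  congr 2 with n
  rw [← mul_add, ← integral_add Integrable.of_finite Integrable.of_finite]
  rfl

lemma value_eq_tsum (s : S) :
    M.value τ μ π s =
      ∑' n : ℕ, M.γ ^ n * ∫ x, M.stageCost τ μ π x ∂((M.stateKernel π ^ n) s) := by
  rw [value, valueE_eq_coe M hτ μ π hkl s, EReal.toReal_coe]

lemma coe_value (s : S) :
    ((M.value τ μ π s : ℝ) : EReal) = M.valueE τ μ (Policy.ofKernel π) s := by
  rw [value_eq_tsum M hτ μ π hkl, valueE_eq_coe M hτ μ π hkl]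

/-- The Bellman equation `V^π = g_π + γ P_π V^π`. -/
lemma value_eq_stageCost_add (s : S) :
    M.value τ μ π s =
      M.stageCost τ μ π s + M.γ * ∫ x, M.value τ μ π x ∂(M.stateKernel π s) := by
  have hpow := isMarkovKernel_pow (M.stateKernel π)
  obtain ⟨K, hK⟩ := exists_abs_le_of_fintype (M.stageCost τ μ π)
  have hsum : ∀ s, Summable fun n => M.γ ^ n *
      ∫ x, M.stageCost τ μ π x ∂((M.stateKernel π ^ n) s) := fun s =>
    M.summable_discounted fun n => abs_integral_le_of_bound _ hK
  simp_rw [value_eq_tsum M hτ μ π hkl]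
  rw [(hsum s).tsum_eq_zero_add]
  congr 1
  · rw [pow_zero, pow_zero, one_mul, show (1 : Kernel S S) = Kernel.id from rfl, Kernel.id_apply,
      integral_dirac]
  · rw [integral_fintype Integrable.of_finite]
    simp_rw [smul_eq_mul, ← tsum_mul_left]
    rw [← Summable.tsum_finsetSum fun x _ => (hsum x).mul_left _, ← tsum_mul_left]
    congr 1 with n
    rw [integral_pow_succ, integral_fintype Integrable.of_finite, Finset.mul_sum, Finset.mul_sum]
    refine Finset.sum_congr rfl fun x _ => ?_
    rw [smul_eq_mul]
    ring

end Finite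

/-- The `Q`-function of `π` averaged over the actions of a further stationary policy `σ`. -/
lemma integral_Q (M : MDP S A) (τ : ℝ) (μ : Measure A) (π σ : Kernel S A) [IsMarkovKernel π]
    [IsMarkovKernel σ] (s : S) :
    ∫ a, M.Q τ μ π s a ∂(σ s) =
      ∫ a, M.c (s, a) ∂(σ s) + M.γ * ∫ x, M.value τ μ π x ∂(M.stateKernel σ s) := by
  obtain ⟨K, hK⟩ := exists_abs_le_of_fintype (M.value τ μ π)
  have hf : StronglyMeasurable (M.value τ μ π) := (measurable_of_finite _).stronglyMeasurable
  unfold Q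
  rw [integral_add (M.integrable_cost _ s), integral_const_mul, integral_stateKernel]
  refine (Integrable.of_bound (C := K) ?_ (ae_of_all _ fun a => ?_)).const_mul _
  · exact (hf.integral_kernel.comp_measurable measurable_prodMk_left).aestronglyMeasurable
  · exact abs_integral_le_of_bound _ hK

lemma measurable_Q (M : MDP S A) (τ : ℝ) (μ : Measure A) (π : Kernel S A) [IsMarkovKernel π]
    (s : S) : Measurable (M.Q τ μ π s) := by
  have hf : StronglyMeasurable (M.value τ μ π) := (measurable_of_finite _).stronglyMeasurable
  exact (M.measurable_c.comp measurable_prodMk_left).add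
    ((hf.integral_kernel.measurable.comp measurable_prodMk_left).const_mul _)

end Bellman
end MDP

/-! ### The occupancy measure -/

namespace MDP
section Occupancy

variable {S A : Type*} [MeasurableSpace S] [MeasurableSpace A]

/-- The occupancy measure solves the flow equation `d = (1 - γ) ρ + γ d P_π`. -/
lemma occupancy_eq (M : MDP S A) (π : Kernel S A) [IsMarkovKernel π] (ρ : Measure S) :
    M.occupancy π ρ = ENNReal.ofReal (1 - M.γ) • ρ +
      ENNReal.ofReal M.γ • (M.occupancy π ρ).bind (M.stateKernel π) := by
  have h1 : 0 ≤ 1 - M.γ := sub_nonneg.2 M.γ_lt_one.le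
  ext B hB
  rw [occupancy, Measure.sum_apply _ hB, tsum_eq_zero_add' ENNReal.summable, Measure.add_apply,
    Measure.smul_apply, Measure.smul_apply, Measure.smul_apply,
    Measure.bind_apply (f := M.stateKernel π) hB (Kernel.aemeasurable _), lintegral_sum_measure]
  congr 1
  · rw [pow_zero, mul_one]
    congr 2
    exact Measure.id_comp
  · rw [smul_eq_mul, ← ENNReal.tsum_mul_left]
    congr 1 with n
    rw [lintegral_smul_measure, pow_succ' (M.stateKernel π),
      show M.stateKernel π * M.stateKernel π ^ n = M.stateKernel π ∘ₖ (M.stateKernel π ^ n) from rfl,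
      ← Measure.comp_assoc, Measure.smul_apply, Measure.bind_apply hB (Kernel.aemeasurable _),
      smul_eq_mul, smul_eq_mul, ← mul_assoc, ← ENNReal.ofReal_mul M.γ_nonneg]
    congr 2
    ring

instance (M : MDP S A) (π : Kernel S A) [IsMarkovKernel π] (ρ : Measure S)
    [IsProbabilityMeasure ρ] : IsProbabilityMeasure (M.occupancy π ρ) := by
  have h1 : 0 ≤ 1 - M.γ := sub_nonneg.2 M.γ_lt_one.le
  have hpow := isMarkovKernel_pow (M.stateKernel π)
  constructor
  rw [occupancy, Measure.sum_apply _ MeasurableSet.univ]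
  simp_rw [Measure.smul_apply, measure_univ, smul_eq_mul, mul_one]
  rw [← ENNReal.ofReal_tsum_of_nonneg (fun n => mul_nonneg h1 (pow_nonneg M.γ_nonneg n))
    ((summable_geometric_of_lt_one M.γ_nonneg M.γ_lt_one).mul_left _), tsum_mul_left,
    tsum_geometric_of_lt_one M.γ_nonneg M.γ_lt_one, mul_inv_cancel₀ (by linarith [M.γ_lt_one]),
    ENNReal.ofReal_one]

lemma absolutelyContinuous_occupancy (M : MDP S A) (π : Kernel S A) [IsMarkovKernel π]
    (ρ : Measure S) : ρ ≪ M.occupancy π ρ := by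
  intro B hB
  rw [occupancy_eq, Measure.add_apply, add_eq_zero, Measure.smul_apply, smul_eq_mul,
    mul_eq_zero] at hB
  refine hB.1.resolve_left ?_
  simpa using M.γ_lt_one

variable [Fintype S] [MeasurableSingletonClass S]

lemma integral_occupancy_eq (M : MDP S A) (π : Kernel S A) [IsMarkovKernel π] (ρ : Measure S)
    [IsProbabilityMeasure ρ] (f : S → ℝ) :
    ∫ x, f x ∂(M.occupancy π ρ) = (1 - M.γ) * ∫ x, f x ∂ρ +
      M.γ * ∫ x, ∫ y, f y ∂(M.stateKernel π x) ∂(M.occupancy π ρ) := by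
  conv_lhs => rw [occupancy_eq]
  rw [integral_add_measure (Integrable.of_finite.smul_measure ENNReal.ofReal_ne_top)
    (Integrable.of_finite.smul_measure ENNReal.ofReal_ne_top), integral_smul_measure,
    integral_smul_measure, ENNReal.toReal_ofReal (sub_nonneg.2 M.γ_lt_one.le),
    ENNReal.toReal_ofReal M.γ_nonneg, smul_eq_mul, smul_eq_mul,
    Measure.comp_eq_comp_const_apply, Kernel.integral_comp Integrable.of_finite,
    Kernel.const_apply]

/-- Nonnegative functions on the state space satisfy `κ_inf ∫ f dd ≤ ∫ f dρ ≤ κ_sup ∫ f dd`,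
with `d` the occupancy measure. -/
lemma kappa_bounds (M : MDP S A) (π : Kernel S A) [IsMarkovKernel π] (ρ : Measure S)
    [IsProbabilityMeasure ρ] {f : S → ℝ} (hf : ∀ s, 0 ≤ f s) :
    M.kappaInf π ρ * ∫ x, f x ∂(M.occupancy π ρ) ≤ ∫ x, f x ∂ρ ∧
      ∫ x, f x ∂ρ ≤ M.kappaSup π ρ * ∫ x, f x ∂(M.occupancy π ρ) := by
  have htop : ∀ᵐ x ∂(M.occupancy π ρ), ρ.rnDeriv (M.occupancy π ρ) x < ⊤ :=
    Measure.rnDeriv_lt_top _ _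
  obtain ⟨C, hC⟩ := exists_abs_le_of_fintype fun x => (ρ.rnDeriv (M.occupancy π ρ) x).toReal
  have hsup : essSup (ρ.rnDeriv (M.occupancy π ρ)) (M.occupancy π ρ) ≠ ⊤ := by
    refine ((essSup_le_of_ae_le (ENNReal.ofReal C) ?_).trans_lt ENNReal.ofReal_lt_top).ne
    filter_upwards [htop] with x hx
    rw [← ENNReal.ofReal_toReal hx.ne]
    exact ENNReal.ofReal_le_ofReal ((le_abs_self _).trans (hC x))
  have h := integral_rnDeriv_smul (f := f) (M.absolutelyContinuous_occupancy π ρ)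
  simp_rw [smul_eq_mul] at h
  rw [← h, ← integral_const_mul, ← integral_const_mul]
  constructor
  · refine integral_mono_ae Integrable.of_finite Integrable.of_finite ?_
    filter_upwards [htop, ae_essInf_le (μ := M.occupancy π ρ)
      (f := ρ.rnDeriv (M.occupancy π ρ))] with x hx h2
    exact mul_le_mul_of_nonneg_right (ENNReal.toReal_mono hx.ne h2) (hf x)
  · refine integral_mono_ae Integrable.of_finite Integrable.of_finite ?_
    filter_upwards [ENNReal.ae_le_essSup (μ := M.occupancy π ρ)
      (ρ.rnDeriv (M.occupancy π ρ))] with x h2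
    exact mul_le_mul_of_nonneg_right (ENNReal.toReal_mono hsup h2) (hf x)

end Occupancy
end MDP

/-! ### Gibbs measures and proximal policies -/

section Gibbs

variable {A : Type*} [MeasurableSpace A] {μ : Measure A} [IsProbabilityMeasure μ]

lemma integrable_exp_of_bound {f : A → ℝ} (hf : Measurable f) {B : ℝ} (hB : ∀ a, |f a| ≤ B) :
    Integrable (fun a => Real.exp (f a)) μ :=
  Integrable.of_bound (C := Real.exp B) (by fun_prop) (ae_of_all _ fun a => by
    rw [Real.norm_eq_abs, abs_of_pos (Real.exp_pos _)]
    exact Real.exp_le_exp.2 ((le_abs_self _).trans (hB a)))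

/-- A tilting by a bounded function has density at most `exp (2 B)` and at least `exp (-2 B)`. -/
lemma abs_sub_log_integral_exp_le {f : A → ℝ} (hf : Measurable f) {B : ℝ} (hB : ∀ a, |f a| ≤ B)
    (a : A) : |f a - Real.log (∫ x, Real.exp (f x) ∂μ)| ≤ 2 * B := by
  have hint := integrable_exp_of_bound (μ := μ) hf hB
  have h1 : Real.exp (-B) ≤ ∫ x, Real.exp (f x) ∂μ := by
    have := integral_mono (μ := μ) (integrable_const (Real.exp (-B))) hint
      fun x => Real.exp_le_exp.2 (neg_le_of_abs_le (hB x))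
    simpa using this
  have h2 : ∫ x, Real.exp (f x) ∂μ ≤ Real.exp B := by
    have := integral_mono (μ := μ) hint (integrable_const (Real.exp B))
      fun x => Real.exp_le_exp.2 (le_of_abs_le (hB x))
    simpa using this
  have h0 := (Real.exp_pos _).trans_le h1
  have h3 := (Real.le_log_iff_exp_le h0).2 h1
  have h4 := (Real.log_le_iff_le_exp h0).2 h2
  have h5 := abs_le.1 (hB a)
  exact abs_le.2 ⟨by linarith [h5.1], by linarith [h5.2]⟩

lemma klDiv_tilted_ne_top {f : A → ℝ} (hf : Measurable f) {B : ℝ} (hB : ∀ a, |f a| ≤ B) :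
    klDiv (μ.tilted f) μ ≠ ⊤ := by
  have hint := integrable_exp_of_bound (μ := μ) hf hB
  have hac := tilted_absolutelyContinuous μ f
  have : IsProbabilityMeasure (μ.tilted f) := isProbabilityMeasure_tilted hint
  refine klDiv_ne_top hac (Integrable.of_bound (C := 2 * B) (by fun_prop) ?_)
  filter_upwards [hac.ae_le (log_rnDeriv_tilted_left_self hint)] with a ha
  rw [llr, ha]
  exact abs_sub_log_integral_exp_le hf hB a

/-- The Gibbs variational identity: the entropy-regularised linear functional is, up to a
constant, the relative entropy with respect to the Gibbs measure `e^{-q/τ} dμ / Z`. -/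
lemma integral_add_klDiv_eq {q : A → ℝ} (hq : Measurable q) {K : ℝ} (hK : ∀ a, |q a| ≤ K) {τ : ℝ}
    (hτ : 0 < τ) (m : Measure A) [IsProbabilityMeasure m] (hm : klDiv m μ ≠ ⊤) :
    klDiv m (μ.tilted fun a => -q a / τ) ≠ ⊤ ∧
      ∫ a, q a ∂m + τ * (klDiv m μ).toReal =
        τ * (klDiv m (μ.tilted fun a => -q a / τ)).toReal -
          τ * Real.log (∫ a, Real.exp (-q a / τ) ∂μ) := by
  have hB : ∀ a, |-q a / τ| ≤ K / τ := fun a => by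
    rw [abs_div, abs_neg, abs_of_pos hτ]
    exact div_le_div_of_nonneg_right (hK a) hτ.le
  have hf : Measurable fun a => -q a / τ := by fun_prop
  have hint := integrable_exp_of_bound (μ := μ) hf hB
  have : IsProbabilityMeasure (μ.tilted fun a => -q a / τ) := isProbabilityMeasure_tilted hint
  obtain ⟨hac, hllr⟩ := klDiv_ne_top_iff.1 hm
  have hfm : Integrable (fun a => -q a / τ) m :=
    Integrable.of_bound (C := K / τ) hf.aestronglyMeasurable (ae_of_all _ hB)
  have hac' := hac.trans (absolutelyContinuous_tilted hint)
  refine ⟨klDiv_ne_top hac' (integrable_llr_tilted_right hac hfm hllr hint), ?_⟩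
  rw [toReal_klDiv_of_measure_eq hac (by simp), toReal_klDiv_of_measure_eq hac' (by simp),
    integral_llr_tilted_right hac hfm hint hllr, integral_div, integral_neg]
  field_simp
  ring

end Gibbs

namespace MDP

lemma exists_abs_Q_le {S A : Type*} [Fintype S] [MeasurableSpace S]
    [MeasurableSpace A] (M : MDP S A) (τ : ℝ) (μ : Measure A) (π : Kernel S A) [IsMarkovKernel π] :
    ∃ K, ∀ s a, |M.Q τ μ π s a| ≤ K := by
  obtain ⟨C, hC⟩ := M.bounded_c
  obtain ⟨K, hK⟩ := exists_abs_le_of_fintype (M.value τ μ π)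
  exact ⟨_, M.abs_Q_le τ μ π hC hK⟩

section Proximal

variable {S A : Type*} [Fintype S] [MeasurableSpace S] [MeasurableSingletonClass S]
  [MeasurableSpace A]

lemma coe_ofReal_mul_klDiv {τ : ℝ} (hτ : 0 ≤ τ) {m μ : Measure A} (hm : klDiv m μ ≠ ⊤) :
    ((ENNReal.ofReal τ * klDiv m μ : ℝ≥0∞) : EReal) = ((τ * (klDiv m μ).toReal : ℝ) : EReal) := by
  rw [← EReal.coe_ennreal_toReal (ENNReal.mul_ne_top ENNReal.ofReal_ne_top hm),
    ENNReal.toReal_mul, ENNReal.toReal_ofReal hτ]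

lemma isProximal_iff (M : MDP S A) {τ : ℝ} (hτ : 0 < τ) (μ : Measure A) [IsProbabilityMeasure μ]
    (π : Kernel S A) [IsMarkovKernel π] (s : S) (m : Measure A) :
    M.IsProximal τ μ π s m ↔ m = μ.tilted fun a => -M.Q τ μ π s a / τ := by
  obtain ⟨K, hK⟩ := M.exists_abs_Q_le τ μ π
  have hQ := M.measurable_Q τ μ π s
  have hf : Measurable fun a => -M.Q τ μ π s a / τ := by fun_prop
  have hB : ∀ a, |-M.Q τ μ π s a / τ| ≤ K / τ := fun a => by
    rw [abs_div, abs_neg, abs_of_pos hτ]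
    exact div_le_div_of_nonneg_right (hK s a) hτ.le
  have hG : IsProbabilityMeasure (μ.tilted fun a => -M.Q τ μ π s a / τ) :=
    isProbabilityMeasure_tilted (integrable_exp_of_bound hf hB)
  have hGμ := klDiv_tilted_ne_top (μ := μ) hf hB
  obtain ⟨-, hid⟩ := integral_add_klDiv_eq (μ := μ) hQ (hK s) hτ _ hGμ
  rw [klDiv_self, ENNReal.toReal_zero, mul_zero, zero_sub] at hid
  constructor
  · rintro ⟨hm, hmin⟩
    have h := hmin _ hG
    rw [coe_ofReal_mul_klDiv hτ.le hGμ, ← EReal.coe_add, hid] at h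
    have hmμ : klDiv m μ ≠ ⊤ := by
      intro htop
      rw [htop, ENNReal.mul_top (by simpa using hτ), EReal.coe_ennreal_top, EReal.coe_add_top] at h
      exact absurd h (not_le.2 (EReal.coe_lt_top _))
    obtain ⟨hne, hid'⟩ := integral_add_klDiv_eq (μ := μ) hQ (hK s) hτ m hmμ
    rw [coe_ofReal_mul_klDiv hτ.le hmμ, ← EReal.coe_add, hid', EReal.coe_le_coe_iff] at h
    have h0 : τ * (klDiv m (μ.tilted fun a => -M.Q τ μ π s a / τ)).toReal ≤ 0 := by linarith
    have h1 := le_antisymm (nonpos_of_mul_nonpos_right h0 hτ) ENNReal.toReal_nonneg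
    exact klDiv_eq_zero_iff.1 (((ENNReal.toReal_eq_zero_iff _).1 h1).resolve_right hne)
  · rintro rfl
    refine ⟨hG, fun m' hm' => ?_⟩
    rw [coe_ofReal_mul_klDiv hτ.le hGμ, ← EReal.coe_add, hid]
    by_cases htop : klDiv m' μ = ⊤
    · rw [htop, ENNReal.mul_top (by simpa using hτ), EReal.coe_ennreal_top, EReal.coe_add_top]
      exact le_top
    · obtain ⟨-, hid'⟩ := integral_add_klDiv_eq (μ := μ) hQ (hK s) hτ m' htop
      rw [coe_ofReal_mul_klDiv hτ.le htop, ← EReal.coe_add, hid', EReal.coe_le_coe_iff]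
      have := mul_nonneg hτ.le (ENNReal.toReal_nonneg
        (a := klDiv m' (μ.tilted fun a => -M.Q τ μ π s a / τ)))
      linarith

end Proximal
end MDP

/-! ### The Holley-Stroock perturbation principle -/

section HolleyStroock

lemma withDensity_le_smul {X : Type*} [MeasurableSpace X] {μ : Measure X} {g : X → ℝ} {b : ℝ}
    (hhi : ∀ a, g a ≤ b) :
    μ.withDensity (fun a => ENNReal.ofReal (g a)) ≤ ENNReal.ofReal b • μ := by
  rw [← withDensity_const]
  exact withDensity_mono (ae_of_all _ fun a => ENNReal.ofReal_le_ofReal (hhi a))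

lemma le_smul_withDensity {X : Type*} [MeasurableSpace X] {μ : Measure X} {g : X → ℝ}
    (hg : Measurable g) {b : ℝ} (hb : 0 < b) (hlo : ∀ a, b⁻¹ ≤ g a) :
    μ ≤ ENNReal.ofReal b • μ.withDensity (fun a => ENNReal.ofReal (g a)) := by
  rw [← withDensity_smul _ hg.ennreal_ofReal]
  conv_lhs => rw [← withDensity_one (μ := μ)]
  refine withDensity_mono (ae_of_all _ fun a => ?_)
  rw [Pi.smul_apply, smul_eq_mul, ← ENNReal.ofReal_mul hb.le, Pi.one_apply, ← ENNReal.ofReal_one]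
  refine ENNReal.ofReal_le_ofReal ?_
  rw [← mul_inv_cancel₀ hb.ne']
  exact mul_le_mul_of_nonneg_left (hlo a) hb.le

lemma klDiv_withDensity_ofReal {X : Type*} [MeasurableSpace X] (μ : Measure X)
    [IsProbabilityMeasure μ] {h : X → ℝ} (hm : Measurable h) (h0 : ∀ a, 0 ≤ h a)
    [IsProbabilityMeasure (μ.withDensity fun a => ENNReal.ofReal (h a))] :
    klDiv (μ.withDensity fun a => ENNReal.ofReal (h a)) μ =
      ∫⁻ a, ENNReal.ofReal (klFun (h a)) ∂μ := by
  rw [klDiv_eq_lintegral_klFun_of_ac (withDensity_absolutelyContinuous _ _)]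
  refine lintegral_congr_ae ?_
  filter_upwards [Measure.rnDeriv_withDensity μ hm.ennreal_ofReal] with a ha
  rw [ha, ENNReal.toReal_ofReal (h0 a)]

/-- For a probability density `h` the function `c ↦ ∫ c klFun (h / c) dm` is minimal at `c = 1`. -/
lemma lintegral_klFun_le {X : Type*} [MeasurableSpace X] (m : Measure X) [IsProbabilityMeasure m]
    {h : X → ℝ} (hint : Integrable h m) (h0 : ∀ a, 0 < h a) (h1 : ∫ a, h a ∂m = 1) {c : ℝ}
    (hc : 0 < c) :
    ∫⁻ a, ENNReal.ofReal (klFun (h a)) ∂m ≤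
      ENNReal.ofReal c * ∫⁻ a, ENNReal.ofReal (klFun (h a / c)) ∂m := by
  have hnn : ∀ x : ℝ, 0 < x → 0 ≤ klFun x := fun x hx => klFun_nonneg hx.le
  have hmeas : AEStronglyMeasurable (fun a => klFun (h a / c)) m :=
    (measurable_klFun.comp_aemeasurable (hint.aemeasurable.div_const c)).aestronglyMeasurable
  by_cases htop : ∫⁻ a, ENNReal.ofReal (klFun (h a / c)) ∂m = ⊤
  · rw [htop, ENNReal.mul_top (by simpa using hc)]
    exact le_top
  have hI : Integrable (fun a => klFun (h a / c)) m :=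
    (lintegral_ofReal_ne_top_iff_integrable hmeas
      (ae_of_all _ fun a => hnn _ (div_pos (h0 a) hc))).1 htop
  have hpt : ∀ a, klFun (h a) = c * klFun (h a / c) + Real.log c * h a + (1 - c) := fun a => by
    rw [klFun_apply, klFun_apply, Real.log_div (h0 a).ne' hc.ne']
    field_simp
    ring
  have hI' : Integrable (fun a => klFun (h a)) m := by
    simp_rw [hpt]
    exact ((hI.const_mul c).add (hint.const_mul _)).add (integrable_const _)
  rw [← ofReal_integral_eq_lintegral_ofReal hI' (ae_of_all _ fun a => hnn _ (h0 a)),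
    ← ofReal_integral_eq_lintegral_ofReal hI (ae_of_all _ fun a => hnn _ (div_pos (h0 a) hc)),
    ← ENNReal.ofReal_mul hc.le]
  refine ENNReal.ofReal_le_ofReal ?_
  simp_rw [hpt]
  have hI2 : Integrable (fun a => c * klFun (h a / c) + Real.log c * h a) m :=
    (hI.const_mul c).add (hint.const_mul _)
  rw [integral_add hI2 (integrable_const _),
    integral_add (hI.const_mul c) (hint.const_mul _), integral_const_mul, integral_const_mul, h1]
  simp only [integral_const, probReal_univ, one_smul]
  linarith [Real.log_le_sub_one_of_pos hc]

/-- The Holley-Stroock perturbation principle. No regularity of the density `g` is needed: if `h`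
is a density with respect to the perturbed measure, the log-Sobolev inequality of `μ` is applied
to the measure with density proportional to `h` with respect to `μ`. -/
theorem LogSobolev.withDensity {d : ℕ} {μ : Measure (EuclideanSpace ℝ (Fin d))}
    [IsProbabilityMeasure μ] {α₀ : ℝ} (hLSI : LogSobolev α₀ μ)
    {g : EuclideanSpace ℝ (Fin d) → ℝ} (hg : Measurable g) {b : ℝ} (hb : 0 < b)
    (hlo : ∀ a, b⁻¹ ≤ g a) (hhi : ∀ a, g a ≤ b)
    [hm : IsProbabilityMeasure (μ.withDensity fun a => ENNReal.ofReal (g a))] :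
    LogSobolev (α₀ / b ^ 2) (μ.withDensity fun a => ENNReal.ofReal (g a)) := by
  have hle := withDensity_le_smul (μ := μ) hhi
  have hge := le_smul_withDensity (μ := μ) hg hb hlo
  generalize μ.withDensity (fun a => ENNReal.ofReal (g a)) = m at hm hle hge
  intro ν hν h hC1 hpos hνm
  have hhm : Measurable h := hC1.continuous.measurable
  have hν1 : ∫⁻ a, ENNReal.ofReal (h a) ∂m = 1 := by
    rw [← setLIntegral_univ, ← withDensity_apply _ MeasurableSet.univ, ← hνm, measure_univ]
  have hint : Integrable h m :=
    (lintegral_ofReal_ne_top_iff_integrable hhm.aestronglyMeasurable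
      (ae_of_all _ fun a => (hpos a).le)).1 (by rw [hν1]; exact ENNReal.one_ne_top)
  have h1 : ∫ a, h a ∂m = 1 := by
    rw [integral_eq_lintegral_of_nonneg_ae (ae_of_all _ fun a => (hpos a).le)
      hhm.aestronglyMeasurable, hν1, ENNReal.toReal_one]
  have hintμ : Integrable h μ := (hint.smul_measure ENNReal.ofReal_ne_top).mono_measure hge
  have hc : 0 < ∫ a, h a ∂μ := by
    rw [integral_pos_iff_support_of_nonneg (fun a => (hpos a).le) hintμ,
      Function.support_eq_univ fun a => (hpos a).ne', measure_univ]
    exact one_pos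
  obtain ⟨c, hcdef⟩ : ∃ c, c = ∫ a, h a ∂μ := ⟨_, rfl⟩
  rw [← hcdef] at hc
  have hν' : IsProbabilityMeasure (μ.withDensity fun a => ENNReal.ofReal (h a / c)) := by
    constructor
    rw [withDensity_apply _ MeasurableSet.univ, setLIntegral_univ,
      ← ofReal_integral_eq_lintegral_ofReal (hintμ.div_const c)
        (ae_of_all _ fun a => (div_pos (hpos a) hc).le), integral_div, ← hcdef, div_self hc.ne',
      ENNReal.ofReal_one]
  have hLS := hLSI _ hν' (fun a => h a / c) (hC1.div_const c) (fun a => div_pos (hpos a) hc) rfl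
  have hgrad : gradient (fun x => Real.log (h x / c)) = gradient fun x => Real.log (h x) := by
    ext1 a
    simp_rw [Real.log_div (hpos _).ne' hc.ne']
    unfold gradient
    rw [fderiv_sub_const]
  rw [klDiv_withDensity_ofReal μ (hhm.div_const c) fun a => (div_pos (hpos a) hc).le, hgrad] at hLS
  have hcν' : ENNReal.ofReal c • μ.withDensity (fun a => ENNReal.ofReal (h a / c)) ≤
      ENNReal.ofReal b • ν := by
    rw [← withDensity_smul _ (hhm.div_const c).ennreal_ofReal, hνm, ← withDensity_smul_measure]
    refine (Measure.le_iff.2 fun s hs => ?_)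
    rw [withDensity_apply _ hs, withDensity_apply _ hs]
    refine (lintegral_mono' (Measure.restrict_mono le_rfl hge) le_rfl).trans
      (lintegral_mono fun a => ?_)
    rw [Pi.smul_apply, smul_eq_mul, ← ENNReal.ofReal_mul hc.le, mul_div_cancel₀ _ hc.ne']
  have : IsProbabilityMeasure (m.withDensity fun a => ENNReal.ofReal (h a)) := hνm ▸ hν
  calc klDiv ν m = ∫⁻ a, ENNReal.ofReal (klFun (h a)) ∂m := by
        rw [hνm, klDiv_withDensity_ofReal m hhm fun a => (hpos a).le]
    _ ≤ ENNReal.ofReal c * ∫⁻ a, ENNReal.ofReal (klFun (h a / c)) ∂m :=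
        lintegral_klFun_le m hint hpos h1 hc
    _ ≤ ENNReal.ofReal c * (ENNReal.ofReal b * ∫⁻ a, ENNReal.ofReal (klFun (h a / c)) ∂μ) := by
        rw [← smul_eq_mul (ENNReal.ofReal b), ← lintegral_smul_measure]
        gcongr
    _ ≤ ENNReal.ofReal c * (ENNReal.ofReal b * (ENNReal.ofReal (1 / (2 * α₀)) *
          ∫⁻ a, ‖gradient (fun x => Real.log (h x)) a‖ₑ ^ 2
            ∂(μ.withDensity fun a => ENNReal.ofReal (h a / c)))) := by
        gcongr
    _ = ENNReal.ofReal b * ENNReal.ofReal (1 / (2 * α₀)) *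
          ∫⁻ a, ‖gradient (fun x => Real.log (h x)) a‖ₑ ^ 2
            ∂(ENNReal.ofReal c • μ.withDensity fun a => ENNReal.ofReal (h a / c)) := by
        rw [lintegral_smul_measure, smul_eq_mul]
        ring
    _ ≤ ENNReal.ofReal b * ENNReal.ofReal (1 / (2 * α₀)) *
          ∫⁻ a, ‖gradient (fun x => Real.log (h x)) a‖ₑ ^ 2 ∂(ENNReal.ofReal b • ν) := by
        gcongr
    _ = ENNReal.ofReal (1 / (2 * (α₀ / b ^ 2))) *
          ∫⁻ a, ‖gradient (fun x => Real.log (h x)) a‖ₑ ^ 2 ∂ν := by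
        rw [lintegral_smul_measure, smul_eq_mul, show 1 / (2 * (α₀ / b ^ 2)) =
          b * b * (1 / (2 * α₀)) by field_simp, ENNReal.ofReal_mul (by positivity),
          ENNReal.ofReal_mul hb.le]
        ring

end HolleyStroock

/-! ### Integration by parts without decay -/

section Divergence

variable {d : ℕ}

lemma sum_apply_single_mul (L : EuclideanSpace ℝ (Fin d) →L[ℝ] ℝ) (v : EuclideanSpace ℝ (Fin d)) :
    ∑ i, L (EuclideanSpace.single i 1) * v i = L v := by
  have h : v = ∑ i, v i • EuclideanSpace.single i (1 : ℝ) := by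
    have := (EuclideanSpace.basisFun (Fin d) ℝ).sum_repr v
    simpa using this.symm
  conv_rhs => rw [h]
  simp [mul_comm]

lemma vectorDiv_smul {u : EuclideanSpace ℝ (Fin d) → ℝ}
    {X : EuclideanSpace ℝ (Fin d) → EuclideanSpace ℝ (Fin d)} {a : EuclideanSpace ℝ (Fin d)}
    (hu : DifferentiableAt ℝ u a) (hX : DifferentiableAt ℝ X a) :
    vectorDiv (fun x => u x • X x) a = u a * vectorDiv X a + fderiv ℝ u a (X a) := by
  unfold vectorDiv
  rw [fderiv_fun_smul hu hX, ← sum_apply_single_mul, Finset.mul_sum, ← Finset.sum_add_distrib]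
  refine Finset.sum_congr rfl fun i _ => ?_
  simp

/-- Divergence theorem on the whole space. Only the divergence of `F` has to be integrable, not
its separate partial derivatives. -/
theorem integral_vectorDiv_eq_zero {F : EuclideanSpace ℝ (Fin d) → EuclideanSpace ℝ (Fin d)}
    (hF : Differentiable ℝ F) (hc : HasCompactSupport F) (hdiv : Integrable (vectorDiv F)) :
    ∫ a, vectorDiv F a = 0 := by
  rcases d with _ | n
  · simp [vectorDiv]
  obtain ⟨R, hR⟩ := hc.isBounded.subset_closedBall 0
  have hzero : ∀ a : EuclideanSpace ℝ (Fin (n + 1)), (∃ i, R < |a i|) → a ∉ tsupport F := by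
    rintro a ⟨i, hi⟩ ha
    have h1 := mem_closedBall_zero_iff.1 (hR ha)
    have h2 := PiLp.norm_apply_le a i
    rw [Real.norm_eq_abs] at h2
    linarith
  obtain ⟨r, hr0, hrR⟩ : ∃ r, 0 ≤ r ∧ R < r := ⟨max 0 (R + 1), le_max_left _ _,
    lt_of_lt_of_le (by linarith) (le_max_right _ _)⟩
  let e := (PiLp.continuousLinearEquiv 2 ℝ (fun _ : Fin (n + 1) => ℝ)).symm
  have hvol := PiLp.volume_preserving_toLp (Fin (n + 1))
  have hemb : MeasurableEmbedding (WithLp.toLp 2 : (Fin (n + 1) → ℝ) → _) :=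
    e.toHomeomorph.measurableEmbedding
  have hdiv' : Integrable fun x : Fin (n + 1) → ℝ => vectorDiv F (WithLp.toLp 2 x) :=
    (hvol.integrable_comp_emb hemb).2 hdiv
  have he : ∀ x, HasFDerivAt (WithLp.toLp 2 : (Fin (n + 1) → ℝ) → EuclideanSpace ℝ (Fin (n + 1)))
      (e : (Fin (n + 1) → ℝ) →L[ℝ] EuclideanSpace ℝ (Fin (n + 1))) x := fun x => e.hasFDerivAt
  have hecont : Continuous
    (WithLp.toLp 2 : (Fin (n + 1) → ℝ) → EuclideanSpace ℝ (Fin (n + 1))) := e.continuous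
  have hbox := integral_divergence_of_hasFDerivAt_off_countable'
    (fun _ : Fin (n + 1) => -r) (fun _ => r) (fun _ => by linarith)
    (fun i x => F (WithLp.toLp 2 x) i)
    (fun i x => (EuclideanSpace.proj i).comp
      ((fderiv ℝ F (WithLp.toLp 2 x)).comp (e : (Fin (n + 1) → ℝ) →L[ℝ] EuclideanSpace ℝ (Fin (n + 1)))))
    ∅ Set.countable_empty
    (fun i => ((EuclideanSpace.proj (𝕜 := ℝ) i).continuous.comp
      (hF.continuous.comp hecont)).continuousOn)
    (fun x _ i => (EuclideanSpace.proj (𝕜 := ℝ) i).hasFDerivAt.comp x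
      ((hF _).hasFDerivAt.comp x (he x)))
    (hdiv'.integrableOn)
  rw [← hvol.integral_comp hemb, ← setIntegral_eq_integral_of_forall_compl_eq_zero
    (s := Set.Icc (fun _ : Fin (n + 1) => -r) (fun _ => r))]
  · refine hbox.trans (Finset.sum_eq_zero fun i _ => ?_)
    have hface : ∀ t : ℝ, |t| = r → ∀ x : Fin n → ℝ,
        F (WithLp.toLp 2 (i.insertNth (α := fun _ => ℝ) t x)) i = 0 := fun t ht x => by
      rw [image_eq_zero_of_notMem_tsupport (hzero _ ⟨i, ?_⟩)]
      · rfl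
      · simpa [ht] using hrR
    simp only [hface r (abs_of_nonneg hr0), hface (-r) (by rw [abs_neg, abs_of_nonneg hr0]),
      integral_zero, sub_zero]
  · intro x hx
    have hx' : ∃ i, R < |WithLp.toLp 2 x i| := by
      by_contra hcon
      push Not at hcon
      exact hx ⟨fun i => (abs_le.1 ((hcon i).trans hrR.le)).1,
        fun i => (abs_le.1 ((hcon i).trans hrR.le)).2⟩
    have : fderiv ℝ F (WithLp.toLp 2 x) = 0 :=
      image_eq_zero_of_notMem_tsupport fun h => hzero _ hx' (tsupport_fderiv_subset ℝ h)
    simp [vectorDiv, this]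

end Divergence

section IntegrationByParts

variable {d : ℕ}

lemma exists_cutoff (d : ℕ) : ∃ (C : ℝ) (χ : ℕ → EuclideanSpace ℝ (Fin d) → ℝ),
    (∀ n, ContDiff ℝ 1 (χ n)) ∧ (∀ n, HasCompactSupport (χ n)) ∧ (∀ n a, 0 ≤ χ n a ∧ χ n a ≤ 1) ∧
      (∀ n a, ‖gradient (χ n) a‖ ≤ C * (n + 1 : ℝ)⁻¹) ∧
        ∀ a, Tendsto (fun n => χ n a) atTop (𝓝 1) := by
  let b : ContDiffBump (0 : EuclideanSpace ℝ (Fin d)) := ⟨1, 2, one_pos, one_lt_two⟩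
  have hb : ContDiff ℝ 1 b := b.contDiff
  have hcs : HasCompactSupport (fderiv ℝ b) := b.hasCompactSupport.fderiv ℝ
  obtain ⟨C, hC⟩ := hcs.exists_bound_of_continuous (hb.continuous_fderiv one_ne_zero)
  have hn : ∀ n : ℕ, (0 : ℝ) < (n + 1 : ℝ)⁻¹ := fun n => by positivity
  refine ⟨C, fun n a => b ((n + 1 : ℝ)⁻¹ • a), fun n => hb.comp (contDiff_const_smul _),
    fun n => b.hasCompactSupport.comp_smul (hn n).ne', fun n a => ⟨b.nonneg, b.le_one⟩,
    fun n a => ?_, fun a => ?_⟩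
  · have h : HasFDerivAt (fun a => b ((n + 1 : ℝ)⁻¹ • a))
        ((n + 1 : ℝ)⁻¹ • fderiv ℝ b ((n + 1 : ℝ)⁻¹ • a)) a := by
      have h1 := ((hb.differentiable one_ne_zero) ((n + 1 : ℝ)⁻¹ • a)).hasFDerivAt.comp a
        ((hasFDerivAt_id a).const_smul ((n + 1 : ℝ)⁻¹))
      convert! h1 using 1
      ext v
      simp
    rw [gradient, LinearIsometryEquiv.norm_map, h.fderiv, norm_smul, Real.norm_eq_abs,
      abs_of_pos (hn n), mul_comm]
    exact mul_le_mul_of_nonneg_right (hC _) (hn n).le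
  · refine tendsto_const_nhds.congr' ?_
    obtain ⟨N, hN⟩ := exists_nat_ge ‖a‖
    filter_upwards [eventually_ge_atTop N] with n hnN
    refine (b.one_of_mem_closedBall ?_).symm
    rw [mem_closedBall_zero_iff, norm_smul, Real.norm_eq_abs, abs_of_pos (hn n)]
    have h2 : (N : ℝ) ≤ n := Nat.cast_le.2 hnN
    change (n + 1 : ℝ)⁻¹ * ‖a‖ ≤ 1
    rw [inv_mul_le_one₀ (by positivity)]
    linarith

/-- Integration by parts for the field `p ∇ψ` with `ψ` bounded: the Dirichlet integral of `ψ`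
is controlled without any decay of `∇ψ`. With the cutoffs `χ`, the cross term
`2 χ ψ p ⟪∇χ, ∇ψ⟫` is split by Young's inequality with the weight `(n + 1)⁻¹`, which tends to `0`
more slowly than `|∇χ|²`. -/
theorem lintegral_norm_gradient_sq_le {ψ p : EuclideanSpace ℝ (Fin d) → ℝ} (hψ : ContDiff ℝ 1 ψ)
    {K : ℝ} (hK : ∀ a, |ψ a| ≤ K) (hp : Continuous p) (hp0 : ∀ a, 0 ≤ p a)
    (hpint : Integrable p) (hX : Differentiable ℝ fun a => p a • gradient ψ a)
    (hdivc : Continuous (vectorDiv fun a => p a • gradient ψ a))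
    (hdiv : Integrable (vectorDiv fun a => p a • gradient ψ a)) :
    0 ≤ -∫ a, ψ a * vectorDiv (fun a => p a • gradient ψ a) a ∧
      ∫⁻ a, ‖gradient ψ a‖ₑ ^ 2 * ENNReal.ofReal (p a) ≤
        ENNReal.ofReal (-∫ a, ψ a * vectorDiv (fun a => p a • gradient ψ a) a) := by
  obtain ⟨C, χ, hχ1, hχc, hχ01, hχg, hχlim⟩ := exists_cutoff d
  set D : EuclideanSpace ℝ (Fin d) → ℝ := vectorDiv fun a => p a • gradient ψ a with hD
  have hψg : Continuous (gradient ψ) :=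
    (InnerProductSpace.toDual ℝ (EuclideanSpace ℝ (Fin d))).symm.continuous.comp
      (hψ.continuous_fderiv one_ne_zero)
  have hχgc : ∀ n, Continuous (gradient (χ n)) := fun n =>
    (InnerProductSpace.toDual ℝ (EuclideanSpace ℝ (Fin d))).symm.continuous.comp
      ((hχ1 n).continuous_fderiv one_ne_zero)
  have hψd : Differentiable ℝ ψ := hψ.differentiable one_ne_zero
  -- the divergence of the truncated field
  have hdivY : ∀ n a, vectorDiv (fun x => (χ n x ^ 2 * ψ x) • (p x • gradient ψ x)) a =
      χ n a ^ 2 * (ψ a * D a) + χ n a ^ 2 * (p a * ‖gradient ψ a‖ ^ 2) +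
        2 * χ n a * ψ a * p a * inner ℝ (gradient (χ n) a) (gradient ψ a) := fun n a => by
    have hχd := (hχ1 n).differentiable one_ne_zero a
    have hχd2 : DifferentiableAt ℝ (fun x => χ n x ^ 2) a := hχd.pow 2
    rw [vectorDiv_smul (u := fun x => χ n x ^ 2 * ψ x) (hχd2.mul (hψd a)) (hX a),
      fderiv_fun_mul hχd2 (hψd a), fderiv_fun_pow 2 hχd]
    simp only [add_apply, smul_apply, smul_eq_mul,
      map_smul, ← inner_gradient_left, real_inner_self_eq_norm_sq]
    rw [← hD]
    simp
    ring
  have hcont : ∀ n, Continuous fun a => χ n a ^ 2 * (ψ a * D a) := fun n =>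
    ((hχ1 n).continuous.pow 2).mul (hψ.continuous.mul hdivc)
  have hcont2 : ∀ n, Continuous fun a => χ n a ^ 2 * (p a * ‖gradient ψ a‖ ^ 2) := fun n =>
    ((hχ1 n).continuous.pow 2).mul (hp.mul (hψg.norm.pow 2))
  have hcont3 : ∀ n, Continuous fun a =>
      2 * χ n a * ψ a * p a * inner ℝ (gradient (χ n) a) (gradient ψ a) := fun n =>
    (((continuous_const.mul (hχ1 n).continuous).mul hψ.continuous).mul hp).mul
      ((hχgc n).inner hψg)
  have hcs2 : ∀ n, HasCompactSupport fun a => χ n a ^ 2 := fun n => by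
    simp_rw [pow_two]
    exact (hχc n).mul_right
  have hI1 : ∀ n, Integrable fun a => χ n a ^ 2 * (ψ a * D a) := fun n =>
    (hcont n).integrable_of_hasCompactSupport (hcs2 n).mul_right
  have hI2 : ∀ n, Integrable fun a => χ n a ^ 2 * (p a * ‖gradient ψ a‖ ^ 2) := fun n =>
    (hcont2 n).integrable_of_hasCompactSupport (hcs2 n).mul_right
  have hI3 : ∀ n, Integrable fun a =>
      2 * χ n a * ψ a * p a * inner ℝ (gradient (χ n) a) (gradient ψ a) := fun n =>
    (hcont3 n).integrable_of_hasCompactSupport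
      (((hχc n).mul_left.mul_right.mul_right).mul_right)
  have hsum : ∀ n, (∫ a, χ n a ^ 2 * (ψ a * D a)) +
      (∫ a, χ n a ^ 2 * (p a * ‖gradient ψ a‖ ^ 2)) +
      (∫ a, 2 * χ n a * ψ a * p a * inner ℝ (gradient (χ n) a) (gradient ψ a)) = 0 := fun n => by
    have hI12 : Integrable fun a => χ n a ^ 2 * (ψ a * D a) +
      χ n a ^ 2 * (p a * ‖gradient ψ a‖ ^ 2) := (hI1 n).add (hI2 n)
    rw [← integral_add (hI1 n) (hI2 n), ← integral_add hI12 (hI3 n)]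
    simp_rw [← hdivY n]
    refine integral_vectorDiv_eq_zero ?_ ?_ ?_
    · exact (((((hχ1 n).differentiable one_ne_zero)).pow 2).mul hψd).smul hX
    · exact (hcs2 n).mul_right.smul_right
    · refine (hI12.add (hI3 n)).congr (ae_of_all _ fun a => ?_)
      exact (hdivY n a).symm
  -- Young's inequality for the cross term
  have hyoung : ∀ (n : ℕ) a,
      -(2 * χ n a * ψ a * p a * inner ℝ (gradient (χ n) a) (gradient ψ a)) ≤
      (n + 1 : ℝ)⁻¹ * (χ n a ^ 2 * (p a * ‖gradient ψ a‖ ^ 2)) +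
        (K ^ 2 * C ^ 2 * (n + 1 : ℝ)⁻¹) * p a := fun n a => by
    have hn : (0 : ℝ) < n + 1 := by positivity
    obtain ⟨h0, -⟩ := hχ01 n a
    have hcs := abs_real_inner_le_norm (gradient (χ n) a) (gradient ψ a)
    have h1 : ‖gradient (χ n) a‖ * (n + 1) ≤ C := by
      have := mul_le_mul_of_nonneg_right (hχg n a) hn.le
      rwa [mul_assoc, inv_mul_cancel₀ hn.ne', mul_one] at this
    have hG := norm_nonneg (gradient (χ n) a)
    have hH := norm_nonneg (gradient ψ a)
    have hK0 := (abs_nonneg _).trans (hK a)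
    have h2 : -(χ n a * ψ a * inner ℝ (gradient (χ n) a) (gradient ψ a)) ≤
        (χ n a * ‖gradient ψ a‖) * (K * ‖gradient (χ n) a‖) := by
      refine (neg_le_abs _).trans ?_
      rw [abs_mul, abs_mul, abs_of_nonneg h0]
      calc χ n a * |ψ a| * |inner ℝ (gradient (χ n) a) (gradient ψ a)|
          ≤ χ n a * K * (‖gradient (χ n) a‖ * ‖gradient ψ a‖) := by
            gcongr
            exact hK a
        _ = _ := by ring
    have h3 : 2 * ((χ n a * ‖gradient ψ a‖) * (K * ‖gradient (χ n) a‖)) ≤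
        (n + 1 : ℝ)⁻¹ * (χ n a * ‖gradient ψ a‖) ^ 2 +
          (n + 1 : ℝ) * (K * ‖gradient (χ n) a‖) ^ 2 := by
      have h4 := mul_nonneg (inv_nonneg.2 hn.le)
        (sq_nonneg (χ n a * ‖gradient ψ a‖ - (n + 1) * (K * ‖gradient (χ n) a‖)))
      have h5 : (n + 1 : ℝ)⁻¹ *
          (χ n a * ‖gradient ψ a‖ - (n + 1) * (K * ‖gradient (χ n) a‖)) ^ 2 =
          (n + 1 : ℝ)⁻¹ * (χ n a * ‖gradient ψ a‖) ^ 2 +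
            (n + 1 : ℝ) * (K * ‖gradient (χ n) a‖) ^ 2 -
              2 * ((χ n a * ‖gradient ψ a‖) * (K * ‖gradient (χ n) a‖)) := by
        field_simp
        ring
      linarith
    have h6 : (n + 1 : ℝ) * (K * ‖gradient (χ n) a‖) ^ 2 ≤ K ^ 2 * C ^ 2 * (n + 1 : ℝ)⁻¹ := by
      rw [← div_eq_mul_inv, le_div_iff₀ hn]
      calc (n + 1 : ℝ) * (K * ‖gradient (χ n) a‖) ^ 2 * (n + 1)
          = K ^ 2 * (‖gradient (χ n) a‖ * (n + 1)) ^ 2 := by ring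
        _ ≤ K ^ 2 * C ^ 2 := by gcongr
    have h7 := mul_le_mul_of_nonneg_right
      ((mul_le_mul_of_nonneg_left h2 zero_le_two).trans (h3.trans
        (add_le_add_right h6 ((n + 1 : ℝ)⁻¹ * (χ n a * ‖gradient ψ a‖) ^ 2)))) (hp0 a)
    calc _ = 2 * -(χ n a * ψ a * inner ℝ (gradient (χ n) a) (gradient ψ a)) * p a := by ring
      _ ≤ _ := h7
      _ = _ := by ring
  have hbound : ∀ n : ℕ,
      ∫ a, (1 - (n + 1 : ℝ)⁻¹) * (χ n a ^ 2 * (p a * ‖gradient ψ a‖ ^ 2)) ≤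
      -(∫ a, χ n a ^ 2 * (ψ a * D a)) + K ^ 2 * C ^ 2 * (n + 1 : ℝ)⁻¹ * ∫ a, p a := fun n => by
    have h1 := integral_mono (hI3 n).neg (((hI2 n).const_mul _).add (hpint.const_mul _)) (hyoung n)
    have h2 := integral_add ((hI2 n).const_mul (n + 1 : ℝ)⁻¹)
      (hpint.const_mul (K ^ 2 * C ^ 2 * (n + 1 : ℝ)⁻¹))
    rw [integral_const_mul, integral_const_mul] at h2
    have h3 := integral_neg (μ := volume) fun a =>
      2 * χ n a * ψ a * p a * inner ℝ (gradient (χ n) a) (gradient ψ a)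
    simp only [Pi.neg_apply, Pi.add_apply] at h1
    rw [h3, h2] at h1
    rw [integral_const_mul]
    linarith [hsum n]
  have hinv : Tendsto (fun n : ℕ => (n + 1 : ℝ)⁻¹) atTop (𝓝 0) := by
    simpa using tendsto_one_div_add_atTop_nhds_zero_nat (𝕜 := ℝ)
  have hlim : Tendsto (fun n : ℕ => -(∫ a, χ n a ^ 2 * (ψ a * D a)) +
      K ^ 2 * C ^ 2 * (n + 1 : ℝ)⁻¹ * ∫ a, p a) atTop (𝓝 (-∫ a, ψ a * D a)) := by
    have h1 : Tendsto (fun n => ∫ a, χ n a ^ 2 * (ψ a * D a)) atTop (𝓝 (∫ a, ψ a * D a)) := by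
      refine tendsto_integral_of_dominated_convergence (fun a => K * |D a|)
        (fun n => (hcont n).aestronglyMeasurable) (hdiv.abs.const_mul K) (fun n => ?_) ?_
      · refine ae_of_all _ fun a => ?_
        obtain ⟨h0, h1⟩ := hχ01 n a
        rw [Real.norm_eq_abs, abs_mul, abs_mul, abs_of_nonneg (sq_nonneg _)]
        calc χ n a ^ 2 * (|ψ a| * |D a|) ≤ 1 * (K * |D a|) := by
              have hψK : |ψ a| * |D a| ≤ K * |D a| := by gcongr; exact hK a
              exact mul_le_mul (pow_le_one₀ h0 h1) hψK
                (mul_nonneg (abs_nonneg _) (abs_nonneg _)) zero_le_one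
          _ = _ := one_mul _
      · refine ae_of_all _ fun a => ?_
        simpa using ((hχlim a).pow 2).mul_const (ψ a * D a)
    have h2 := h1.neg.add ((hinv.const_mul (K ^ 2 * C ^ 2)).mul_const (∫ a, p a))
    simpa using h2
  have hnn : ∀ (n : ℕ) a,
      0 ≤ (1 - (n + 1 : ℝ)⁻¹) * (χ n a ^ 2 * (p a * ‖gradient ψ a‖ ^ 2)) := fun n a => by
    refine mul_nonneg (sub_nonneg.2 (inv_le_one_of_one_le₀ ?_))
      (mul_nonneg (sq_nonneg _) (mul_nonneg (hp0 a) (sq_nonneg _)))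
    exact le_add_of_nonneg_left (Nat.cast_nonneg n)
  have hpt : ∀ a, ‖gradient ψ a‖ₑ ^ 2 * ENNReal.ofReal (p a) = liminf (fun n : ℕ =>
      ENNReal.ofReal ((1 - (n + 1 : ℝ)⁻¹) * (χ n a ^ 2 * (p a * ‖gradient ψ a‖ ^ 2)))) atTop := by
    intro a
    refine (Tendsto.liminf_eq ?_).symm
    have h1 : ‖gradient ψ a‖ₑ ^ 2 * ENNReal.ofReal (p a) =
        ENNReal.ofReal ((1 - 0) * (1 ^ 2 * (p a * ‖gradient ψ a‖ ^ 2))) := by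
      rw [sub_zero, one_mul, one_pow, one_mul, ENNReal.ofReal_mul (hp0 a),
        ENNReal.ofReal_pow (norm_nonneg _), ofReal_norm, mul_comm]
    rw [h1]
    exact ENNReal.tendsto_ofReal
      ((tendsto_const_nhds.sub hinv).mul (((hχlim a).pow 2).mul_const _))
  refine ⟨ge_of_tendsto' hlim fun n => (integral_nonneg (hnn n)).trans (hbound n), ?_⟩
  simp_rw [hpt]
  refine (lintegral_liminf_le fun n => ?_).trans ?_
  · exact (((hcont2 n).measurable).const_mul _).ennreal_ofReal
  · rw [← (ENNReal.tendsto_ofReal hlim).liminf_eq]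
    refine liminf_le_liminf (Eventually.of_forall fun n => ?_)
    rw [← ofReal_integral_eq_lintegral_ofReal ((hI2 n).const_mul _) (ae_of_all _ (hnn n))]
    exact ENNReal.ofReal_le_ofReal (hbound n)

end IntegrationByParts

/-! ### Fixed points of discounted kernels -/

section FixedPoint

variable {S : Type*} [Fintype S] [MeasurableSpace S] [MeasurableSingletonClass S]

lemma le_div_of_le_add_integral (κ : Kernel S S) [IsMarkovKernel κ] {γ : ℝ} (hγ0 : 0 ≤ γ)
    (hγ1 : γ < 1) {y : S → ℝ} {ε : ℝ} (h : ∀ s, y s ≤ ε + γ * ∫ x, y x ∂(κ s)) (s : S) :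
    y s ≤ ε / (1 - γ) := by
  obtain ⟨s₀, -, hs₀⟩ := Finset.exists_max_image Finset.univ y ⟨s, Finset.mem_univ s⟩
  refine (hs₀ s (Finset.mem_univ s)).trans ?_
  have h1 : ∫ x, y x ∂(κ s₀) ≤ y s₀ := by
    have := integral_mono (μ := κ s₀) Integrable.of_finite (integrable_const (y s₀))
      fun x => hs₀ x (Finset.mem_univ x)
    simpa using this
  rw [le_div_iff₀ (sub_pos.2 hγ1)]
  linarith [h s₀, mul_le_mul_of_nonneg_left h1 hγ0]

lemma exists_solution (κ : Kernel S S) [IsMarkovKernel κ] {γ : ℝ} (hγ0 : 0 ≤ γ)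
    (hγ1 : γ < 1) (f : S → ℝ) :
    ∃ w : S → ℝ, ∀ s, w s = f s + γ * ∫ x, w x ∂(κ s) := by
  let L : (S → ℝ) →ₗ[ℝ] (S → ℝ) :=
    { toFun := fun w s => w s - γ * ∫ x, w x ∂(κ s)
      map_add' := fun u w => by
        ext s
        simp only [Pi.add_apply]
        rw [integral_add Integrable.of_finite Integrable.of_finite]
        ring
      map_smul' := fun c w => by
        ext s
        simp only [Pi.smul_apply, smul_eq_mul, RingHom.id_apply]
        rw [integral_const_mul]
        ring }
  have hinj : Function.Injective L := by
    rw [← LinearMap.ker_eq_bot, LinearMap.ker_eq_bot']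
    intro w hw
    ext s
    have hw' : ∀ s, w s - γ * ∫ x, w x ∂(κ s) = 0 := fun s => congrFun hw s
    have h1 := le_div_of_le_add_integral κ hγ0 hγ1 (y := w) (ε := 0)
      (fun s => by linarith [hw' s]) s
    have h2 := le_div_of_le_add_integral κ hγ0 hγ1 (y := fun s => -w s) (ε := 0)
      (fun s => by rw [integral_neg]; linarith [hw' s]) s
    rw [zero_div] at h1 h2
    exact le_antisymm h1 (neg_nonpos.1 h2)
  obtain ⟨w, hw⟩ := LinearMap.injective_iff_surjective.1 hinj f
  exact ⟨w, fun s => by linarith [show w s - γ * ∫ x, w x ∂(κ s) = f s from congrFun hw s]⟩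

variable (κ : ℝ → Kernel S S) [∀ r, IsMarkovKernel (κ r)] {γ : ℝ} (hγ0 : 0 ≤ γ) (hγ1 : γ < 1)

include hγ0 hγ1

/-- The inverses of `1 - γ κ_r` are bounded uniformly in `r`. -/
lemma tendsto_zero_of_sub_integral {l : Filter ℝ} {y : ℝ → S → ℝ}
    (h : ∀ s, Tendsto (fun r => y r s - γ * ∫ x, y r x ∂(κ r s)) l (𝓝 0)) (s : S) :
    Tendsto (fun r => y r s) l (𝓝 0) := by
  have hsum : Tendsto (fun r => (∑ s, |y r s - γ * ∫ x, y r x ∂(κ r s)|) / (1 - γ)) l (𝓝 0) := by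
    have := (tendsto_finsetSum Finset.univ fun s _ => (h s).abs).div_const (1 - γ)
    simpa using this
  refine squeeze_zero_norm (fun r => ?_) hsum
  have hle : ∀ s, |y r s - γ * ∫ x, y r x ∂(κ r s)| ≤
      ∑ s, |y r s - γ * ∫ x, y r x ∂(κ r s)| := fun s =>
    Finset.single_le_sum (f := fun s => |y r s - γ * ∫ x, y r x ∂(κ r s)|)
      (fun _ _ => abs_nonneg _) (Finset.mem_univ s)
  have h1 := le_div_of_le_add_integral (κ r) hγ0 hγ1 (y := y r)
    (ε := ∑ s, |y r s - γ * ∫ x, y r x ∂(κ r s)|) (fun s => by linarith [le_of_abs_le (hle s)]) s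
  have h2 := le_div_of_le_add_integral (κ r) hγ0 hγ1 (y := fun s => -y r s)
    (ε := ∑ s, |y r s - γ * ∫ x, y r x ∂(κ r s)|) (fun s => by rw [integral_neg]; linarith [neg_le_of_abs_le (hle s)]) s
  rw [Real.norm_eq_abs]
  exact abs_le.2 ⟨by linarith, h1⟩

variable {g v : ℝ → S → ℝ}

lemma tendsto_fixedPoint {l : Filter ℝ} {t : ℝ}
    (hv : ∀ᶠ r in l, ∀ s, v r s = g r s + γ * ∫ x, v r x ∂(κ r s))
    (he : ∀ s, Tendsto (fun r => g r s + γ * ∫ x, v t x ∂(κ r s)) l (𝓝 (v t s))) (s : S) :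
    Tendsto (fun r => v r s) l (𝓝 (v t s)) := by
  refine tendsto_sub_nhds_zero_iff.1
    (tendsto_zero_of_sub_integral κ hγ0 hγ1 (y := fun r s => v r s - v t s) (fun s => ?_) s)
  refine (tendsto_sub_nhds_zero_iff.2 (he s)).congr' ?_
  filter_upwards [hv] with r hr
  rw [integral_sub Integrable.of_finite Integrable.of_finite]
  linarith [hr s]

/-- Implicit differentiation of `v = g + γ κ v`: only the derivative of `g + γ κ v_t` with the
value `v_t` frozen is needed. -/
lemma hasDerivAt_fixedPoint {t : ℝ}
    (hv : ∀ᶠ r in 𝓝 t, ∀ s, v r s = g r s + γ * ∫ x, v r x ∂(κ r s))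
    (hκ : ∀ (f : S → ℝ) (s : S), ContinuousAt (fun r => ∫ x, f x ∂(κ r s)) t) {f : S → ℝ}
    (he : ∀ s, HasDerivAt (fun r => g r s + γ * ∫ x, v t x ∂(κ r s)) (f s) t) :
    ∃ w : S → ℝ, (∀ s, HasDerivAt (fun r => v r s) (w s) t) ∧
      ∀ s, w s = f s + γ * ∫ x, w x ∂(κ t s) := by
  obtain ⟨w, hw⟩ := exists_solution (κ t) hγ0 hγ1 f
  refine ⟨w, fun s => ?_, hw⟩
  rw [hasDerivAt_iff_tendsto_slope]
  refine tendsto_sub_nhds_zero_iff.1 (tendsto_zero_of_sub_integral κ hγ0 hγ1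
    (y := fun r s => slope (fun r => v r s) t r - w s) (fun s => ?_) s)
  have h1 := hasDerivAt_iff_tendsto_slope.1 (he s)
  have h2 : Tendsto (fun r => ∫ x, w x ∂(κ r s)) (𝓝[≠] t) (𝓝 (∫ x, w x ∂(κ t s))) :=
    (hκ w s).tendsto.mono_left nhdsWithin_le_nhds
  have h3 := (h1.sub_const (w s)).add (h2.const_mul γ)
  rw [show f s - w s + γ * ∫ x, w x ∂(κ t s) = 0 by linarith [hw s]] at h3
  refine h3.congr' ?_
  filter_upwards [hv.filter_mono nhdsWithin_le_nhds] with r hr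
  simp only [slope_def_field]
  rw [integral_sub Integrable.of_finite Integrable.of_finite, integral_div,
    integral_sub Integrable.of_finite Integrable.of_finite, hr s]
  have ht := hv.self_of_nhds s
  rw [← ht]
  ring

end FixedPoint

/-! ### Densities along the flow -/

section GibbsDensity

variable {d : ℕ} {U : EuclideanSpace ℝ (Fin d) → ℝ}

lemma refMeasure_withDensity (hU : Continuous U) {φ : EuclideanSpace ℝ (Fin d) → ℝ}
    (hφ : Measurable φ) :
    (refMeasure U).withDensity (fun a => ENNReal.ofReal (Real.exp (φ a))) =
      volume.withDensity fun a => ENNReal.ofReal (Real.exp (φ a - U a)) := by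
  have hUm := hU.measurable
  rw [refMeasure, ← withDensity_mul _ (by fun_prop) (by fun_prop)]
  congr 1 with a
  rw [Pi.mul_apply, ← ENNReal.ofReal_mul (Real.exp_pos _).le, ← Real.exp_add]
  congr 2
  ring

lemma tilted_eq_withDensity_exp {A : Type*} [MeasurableSpace A] (μ : Measure A) [NeZero μ]
    {f : A → ℝ} (hf : Integrable (fun a => Real.exp (f a)) μ) :
    μ.tilted f = μ.withDensity fun a =>
      ENNReal.ofReal (Real.exp (f a - Real.log (∫ x, Real.exp (f x) ∂μ))) := by
  rw [Measure.tilted]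
  congr 1 with a
  rw [Real.exp_sub, Real.exp_log (integral_exp_pos hf)]

variable {S : Type*} [MeasurableSpace S] {M : MDP S (EuclideanSpace ℝ (Fin d))} {τ : ℝ}
  {π : ℝ → Kernel S (EuclideanSpace ℝ (Fin d))} [∀ t, IsMarkovKernel (π t)]
  {p : ℝ → S → EuclideanSpace ℝ (Fin d) → ℝ}

/-- Along a regular flow, `π_t` has a log-density `φ` with respect to the reference measure that
is bounded uniformly on compact time intervals. -/
lemma IsRegularFlow.exists_logDensity (hflow : IsRegularFlow M τ U π p) (hU : Continuous U)
    (hμ : IsProbabilityMeasure (refMeasure U)) (T : ℝ) :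
    ∃ B : ℝ, ∀ t, 0 ≤ t → t ≤ T → ∀ s, ∃ φ : EuclideanSpace ℝ (Fin d) → ℝ,
      (∀ a, |φ a| ≤ B) ∧ klDiv (π t s) (refMeasure U) ≠ ⊤ ∧
      (klDiv (π t s) (refMeasure U)).toReal = ∫ a, φ a ∂(π t s) ∧
      p t s =ᵐ[volume] fun a => Real.exp (φ a - U a) := by
  obtain ⟨B, hB⟩ := hflow.mem_gibbs T
  refine ⟨2 * B, fun t ht0 htT s => ?_⟩
  obtain ⟨f, hfm, hfB, hπ⟩ := hB t ht0 htT
  have hm : Measurable fun a => f (s, a) := hfm.comp measurable_prodMk_left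
  have hint := integrable_exp_of_bound (μ := refMeasure U) hm fun a => hfB (s, a)
  have hac := tilted_absolutelyContinuous (refMeasure U) fun a => f (s, a)
  refine ⟨fun a => f (s, a) - Real.log (∫ x, Real.exp (f (s, x)) ∂(refMeasure U)),
    abs_sub_log_integral_exp_le hm fun a => hfB (s, a), ?_, ?_, ?_⟩
  · rw [hπ s]
    exact klDiv_tilted_ne_top hm fun a => hfB (s, a)
  · rw [← hπ s] at hac
    rw [toReal_klDiv_of_measure_eq hac (by simp)]
    refine integral_congr_ae ?_
    filter_upwards [hac.ae_le (log_rnDeriv_tilted_left_self hint)] with a ha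
    rw [← ha, llr, hπ s]
  · have h1 := hflow.density t ht0 s
    rw [hπ s, tilted_eq_withDensity_exp _ hint, refMeasure_withDensity hU (by fun_prop),
      withDensity_eq_iff_of_sigmaFinite (by have := hU.measurable; fun_prop)
        (hflow.measurable_density t ht0 s).ennreal_ofReal.aemeasurable] at h1
    filter_upwards [h1] with a ha
    have hpos : 0 < p t s a := ENNReal.ofReal_pos.1 (ha ▸ ENNReal.ofReal_pos.2 (Real.exp_pos _))
    exact ((ENNReal.ofReal_eq_ofReal_iff (Real.exp_pos _).le hpos.le).1 ha).symm

lemma IsRegularFlow.klDiv_ne_top (hflow : IsRegularFlow M τ U π p) (hU : Continuous U)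
    (hμ : IsProbabilityMeasure (refMeasure U)) {t : ℝ} (ht : 0 ≤ t) (s : S) :
    klDiv (π t s) (refMeasure U) ≠ ⊤ := by
  obtain ⟨B, hB⟩ := hflow.exists_logDensity hU hμ t
  obtain ⟨φ, -, h, -⟩ := hB t ht le_rfl s
  exact h

lemma IsRegularFlow.ae_pos (hflow : IsRegularFlow M τ U π p) (hU : Continuous U)
    (hμ : IsProbabilityMeasure (refMeasure U)) {t : ℝ} (ht : 0 ≤ t) (s : S) :
    ∀ᵐ a, 0 < p t s a := by
  obtain ⟨B, hB⟩ := hflow.exists_logDensity hU hμ t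
  obtain ⟨φ, -, -, -, h⟩ := hB t ht le_rfl s
  filter_upwards [h] with a ha
  rw [ha]
  exact Real.exp_pos _

lemma IsRegularFlow.integral_eq (hflow : IsRegularFlow M τ U π p) (hU : Continuous U)
    (hμ : IsProbabilityMeasure (refMeasure U)) {t : ℝ} (ht : 0 ≤ t) (s : S)
    (g : EuclideanSpace ℝ (Fin d) → ℝ) : ∫ a, g a ∂(π t s) = ∫ a, p t s a * g a := by
  rw [hflow.density t ht s, integral_withDensity_eq_integral_toReal_smul
    (hflow.measurable_density t ht s).ennreal_ofReal (ae_of_all _ fun a => ENNReal.ofReal_lt_top)]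
  refine integral_congr_ae ?_
  filter_upwards [hflow.ae_pos hU hμ ht s] with a ha
  rw [ENNReal.toReal_ofReal ha.le, smul_eq_mul]

lemma IsRegularFlow.integrable_density (hflow : IsRegularFlow M τ U π p) (hU : Continuous U)
    (hμ : IsProbabilityMeasure (refMeasure U)) {t : ℝ} (ht : 0 ≤ t) (s : S) :
    Integrable (p t s) := by
  refine (lintegral_ofReal_ne_top_iff_integrable
    (hflow.measurable_density t ht s).aestronglyMeasurable ?_).1 ?_
  · filter_upwards [hflow.ae_pos hU hμ ht s] with a ha using ha.le
  · rw [← setLIntegral_univ, ← withDensity_apply _ MeasurableSet.univ, ← hflow.density t ht s,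
      measure_univ]
    exact ENNReal.one_ne_top

lemma IsRegularFlow.integral_density (hflow : IsRegularFlow M τ U π p) (hU : Continuous U)
    (hμ : IsProbabilityMeasure (refMeasure U)) {t : ℝ} (ht : 0 ≤ t) (s : S) :
    ∫ a, p t s a = 1 := by
  have := hflow.integral_eq hU hμ ht s fun _ => 1
  simpa using this.symm

lemma IsRegularFlow.toReal_klDiv (hflow : IsRegularFlow M τ U π p) (hU : Continuous U)
    (hμ : IsProbabilityMeasure (refMeasure U)) {t : ℝ} (ht : 0 ≤ t) (s : S) :
    (klDiv (π t s) (refMeasure U)).toReal = ∫ a, p t s a * (Real.log (p t s a) + U a) := by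
  obtain ⟨B, hB⟩ := hflow.exists_logDensity hU hμ t
  obtain ⟨φ, -, -, hkl, h⟩ := hB t ht le_rfl s
  rw [hkl, hflow.integral_eq hU hμ ht]
  refine integral_congr_ae ?_
  filter_upwards [h] with a ha
  rw [ha, Real.log_exp, sub_add_cancel]

lemma IsRegularFlow.exists_ae_bound (hflow : IsRegularFlow M τ U π p) (hU : Continuous U)
    (hμ : IsProbabilityMeasure (refMeasure U)) (T : ℝ) :
    ∃ B : ℝ, ∀ t, 0 ≤ t → t ≤ T → ∀ s, ∀ᵐ a, 0 < p t s a ∧ |Real.log (p t s a) + U a| ≤ B := by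
  obtain ⟨B, hB⟩ := hflow.exists_logDensity hU hμ T
  refine ⟨B, fun t ht0 htT s => ?_⟩
  obtain ⟨φ, hφ, -, -, h⟩ := hB t ht0 htT s
  filter_upwards [h] with a ha
  rw [ha, Real.log_exp, sub_add_cancel]
  exact ⟨Real.exp_pos _, hφ a⟩

/-- For positive times the bounds on the density hold everywhere, by continuity. -/
lemma IsRegularFlow.exists_bound (hflow : IsRegularFlow M τ U π p) (hU : Continuous U)
    (hμ : IsProbabilityMeasure (refMeasure U)) (T : ℝ) :
    ∃ B : ℝ, ∀ t, 0 < t → t ≤ T → ∀ s a, 0 < p t s a ∧ |Real.log (p t s a) + U a| ≤ B := by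
  obtain ⟨B, hB⟩ := hflow.exists_ae_bound hU hμ T
  refine ⟨B, fun t ht0 htT s a => ?_⟩
  have hp : Continuous (p t s) := (hflow.contDiff_space t ht0 s).continuous
  have hcl : IsClosed ({a | Real.exp (-B - U a) ≤ p t s a} ∩ {a | p t s a ≤ Real.exp (B - U a)}) :=
    (isClosed_le (by fun_prop) hp).inter (isClosed_le hp (by fun_prop))
  have huniv : ({a | Real.exp (-B - U a) ≤ p t s a} ∩ {a | p t s a ≤ Real.exp (B - U a)}) =
      Set.univ := by
    rw [← hcl.ae_eq_univ_iff_eq (μ := volume), ae_eq_univ]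
    refine (hB t ht0.le htT s).mono fun a ha => ?_
    obtain ⟨h1, h2⟩ := abs_le.1 ha.2
    exact ⟨(Real.le_log_iff_exp_le ha.1).1 (by linarith),
      (Real.log_le_iff_le_exp ha.1).1 (by linarith)⟩
  obtain ⟨h1, h2⟩ := (Set.eq_univ_iff_forall.1 huniv) a
  have h0 : 0 < p t s a := (Real.exp_pos _).trans_le h1
  refine ⟨h0, abs_le.2 ⟨?_, ?_⟩⟩
  · linarith [(Real.le_log_iff_exp_le h0).2 h1]
  · linarith [(Real.log_le_iff_le_exp h0).2 h2]

end GibbsDensity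

/-! ### Time derivatives and the initial value -/

section TimeDerivative

lemma integrable_exp_neg_mul_sq_norm (d : ℕ) {δ : ℝ} (hδ : 0 < δ) :
    Integrable fun a : EuclideanSpace ℝ (Fin d) => Real.exp (-(δ * ‖a‖ ^ 2)) := by
  have h := (GaussianFourier.integrable_cexp_neg_mul_sq_norm_add (b := (δ : ℂ)) (by simpa using hδ)
    0 (0 : EuclideanSpace ℝ (Fin d))).norm
  refine h.congr (ae_of_all _ fun a => ?_)
  simp only [Complex.norm_exp]
  congr 1
  rw [zero_mul, add_zero, ← Complex.ofReal_pow, ← Complex.ofReal_neg, ← Complex.ofReal_mul,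
    Complex.ofReal_re, neg_mul]

/-- The function `x ↦ x (log x + u)` is Lipschitz where `|log x + u|` is bounded. -/
lemma abs_mul_log_add_sub_le {x y u B : ℝ} (hx : 0 < x) (hy : 0 < y) (hxB : |Real.log x + u| ≤ B)
    (hyB : |Real.log y + u| ≤ B) :
    |x * (Real.log x + u) - y * (Real.log y + u)| ≤ (B + 1) * |x - y| := by
  wlog h : y ≤ x generalizing x y
  · rw [abs_sub_comm, abs_sub_comm x]
    exact this hy hx hyB hxB (le_of_not_ge h)
  have h1 : 0 ≤ y * (Real.log x - Real.log y) :=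
    mul_nonneg hy.le (sub_nonneg.2 (Real.log_le_log hy h))
  have h2 : y * (Real.log x - Real.log y) ≤ x - y := by
    rw [← Real.log_div hx.ne' hy.ne']
    have := mul_le_mul_of_nonneg_left (Real.log_le_sub_one_of_pos (div_pos hx hy)) hy.le
    rwa [mul_sub, mul_div_cancel₀ _ hy.ne', mul_one] at this
  have h3 : |(x - y) * (Real.log x + u)| ≤ B * |x - y| := by
    rw [abs_mul, mul_comm]
    exact mul_le_mul_of_nonneg_right hxB (abs_nonneg _)
  have h4 : x * (Real.log x + u) - y * (Real.log y + u) =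
      (x - y) * (Real.log x + u) + y * (Real.log x - Real.log y) := by ring
  rw [h4]
  refine (abs_add_le _ _).trans ?_
  rw [abs_of_nonneg h1, add_mul, one_mul]
  exact add_le_add h3 (h2.trans (le_abs_self _))

variable {d : ℕ} {U : EuclideanSpace ℝ (Fin d) → ℝ}
  {S : Type*} [MeasurableSpace S] {M : MDP S (EuclideanSpace ℝ (Fin d))} {τ : ℝ}
  {π : ℝ → Kernel S (EuclideanSpace ℝ (Fin d))} [∀ t, IsMarkovKernel (π t)]
  {p : ℝ → S → EuclideanSpace ℝ (Fin d) → ℝ}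

lemma IsRegularFlow.continuous_deriv (hflow : IsRegularFlow M τ U π p) {t : ℝ} (ht : 0 < t)
    (s : S) : Continuous fun a => deriv (fun r => p r s a) t :=
  (hflow.continuousOn_time s).comp_continuous (f := fun a => (t, a)) (by fun_prop)
    fun a => ⟨ht, Set.mem_univ a⟩

/-- An integrable bound for the time derivative that is uniform near a positive time. -/
lemma IsRegularFlow.exists_deriv_bound (hflow : IsRegularFlow M τ U π p) {t : ℝ} (ht : 0 < t)
    (s : S) : ∃ b : EuclideanSpace ℝ (Fin d) → ℝ, Integrable b ∧
      ∀ r ∈ Set.Ioo (t / 2) (2 * t), ∀ a, |deriv (fun r => p r s a) r| ≤ b a := by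
  obtain ⟨K, δ, -, hδ, h⟩ := hflow.gaussian_bound s (t / 2) (2 * t) (by linarith)
  refine ⟨_, (integrable_exp_neg_mul_sq_norm d hδ).const_mul K, fun r hr a => ?_⟩
  linarith [h r hr.1.le hr.2.le a, abs_nonneg (p r s a), norm_nonneg (gradient (p r s) a)]

lemma Ioo_mem_nhds_pos {t : ℝ} (ht : 0 < t) : Set.Ioo (t / 2) (2 * t) ∈ 𝓝 t :=
  Ioo_mem_nhds (by linarith) (by linarith)

lemma IsRegularFlow.integrable_deriv (hflow : IsRegularFlow M τ U π p) {t : ℝ} (ht : 0 < t)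
    (s : S) : Integrable fun a => deriv (fun r => p r s a) t := by
  obtain ⟨b, hb, h⟩ := hflow.exists_deriv_bound ht s
  exact hb.mono' (hflow.continuous_deriv ht s).aestronglyMeasurable
    (ae_of_all _ fun a => h t (mem_of_mem_nhds (Ioo_mem_nhds_pos ht)) a)

variable (hflow : IsRegularFlow M τ U π p) (hU : Continuous U)
  (hμ : IsProbabilityMeasure (refMeasure U))

include hflow hU hμ

lemma IsRegularFlow.hasDerivAt_integral_mul {t : ℝ} (ht : 0 < t) (s : S)
    {φ : EuclideanSpace ℝ (Fin d) → ℝ} (hφ : Measurable φ) {C : ℝ} (hC : ∀ a, |φ a| ≤ C) :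
    HasDerivAt (fun r => ∫ a, p r s a * φ a) (∫ a, deriv (fun r => p r s a) t * φ a) t := by
  obtain ⟨b, hb, h⟩ := hflow.exists_deriv_bound ht s
  refine (hasDerivAt_integral_of_dominated_loc_of_deriv_le (F := fun r a => p r s a * φ a)
    (F' := fun r a => deriv (fun r => p r s a) r * φ a) (bound := fun a => b a * C)
    (Ioo_mem_nhds_pos ht) ?_ ?_ ?_ (ae_of_all _ fun a r hr => ?_) (hb.mul_const C)
    (ae_of_all _ fun a r hr => ?_)).2
  · filter_upwards [Ioo_mem_nhds_pos ht] with r hr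
    exact ((hflow.measurable_density r (by linarith [hr.1]) s).mul hφ).aestronglyMeasurable
  · exact (hflow.integrable_density hU hμ ht.le s).mul_bdd (c := C) hφ.aestronglyMeasurable
      (ae_of_all _ hC)
  · exact ((hflow.continuous_deriv ht s).measurable.mul hφ).aestronglyMeasurable
  · rw [norm_mul]
    exact mul_le_mul (h r hr a) (hC a) (abs_nonneg _) ((abs_nonneg _).trans (h r hr a))
  · exact (hflow.differentiable_time r (by linarith [hr.1]) s a).hasDerivAt.mul_const (φ a)

/-- Conservation of mass. -/
lemma IsRegularFlow.integral_deriv_eq_zero {t : ℝ} (ht : 0 < t) (s : S) :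
    ∫ a, deriv (fun r => p r s a) t = 0 := by
  have h1 := hflow.hasDerivAt_integral_mul hU hμ ht s (φ := fun _ => 1) measurable_const (C := 1)
    (fun _ => by simp)
  simp only [mul_one] at h1
  refine h1.unique ((hasDerivAt_const t (1 : ℝ)).congr_of_eventuallyEq ?_)
  filter_upwards [Ioi_mem_nhds ht] with r hr
  exact hflow.integral_density hU hμ (le_of_lt hr) s

lemma IsRegularFlow.hasDerivAt_entropy {t : ℝ} (ht : 0 < t) (s : S) :
    HasDerivAt (fun r => ∫ a, p r s a * (Real.log (p r s a) + U a))
      (∫ a, deriv (fun r => p r s a) t * (Real.log (p t s a) + U a)) t := by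
  obtain ⟨b, hb, h⟩ := hflow.exists_deriv_bound ht s
  obtain ⟨B, hB⟩ := hflow.exists_bound hU hμ (2 * t)
  have hB' : ∀ r ∈ Set.Ioo (t / 2) (2 * t), ∀ a, 0 < p r s a ∧ |Real.log (p r s a) + U a| ≤ B :=
    fun r hr => hB r (by linarith [hr.1]) hr.2.le s
  have htI := mem_of_mem_nhds (Ioo_mem_nhds_pos ht)
  have hmeas : ∀ r, 0 ≤ r → Measurable fun a => Real.log (p r s a) + U a := fun r hr =>
    (hflow.measurable_density r hr s).log.add hU.measurable
  have hmain : HasDerivAt (fun r => ∫ a, p r s a * (Real.log (p r s a) + U a))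
      (∫ a, deriv (fun r => p r s a) t * (Real.log (p t s a) + U a + 1)) t := by
    refine (hasDerivAt_integral_of_dominated_loc_of_deriv_le
      (F := fun r a => p r s a * (Real.log (p r s a) + U a))
      (F' := fun r a => deriv (fun r => p r s a) r * (Real.log (p r s a) + U a + 1))
      (bound := fun a => b a * (B + 1))
      (Ioo_mem_nhds_pos ht) ?_ ?_ ?_ (ae_of_all _ fun a r hr => ?_) (hb.mul_const _)
      (ae_of_all _ fun a r hr => ?_)).2
    · filter_upwards [Ioo_mem_nhds_pos ht] with r hr
      have hr0 : 0 ≤ r := by linarith [hr.1]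
      exact ((hflow.measurable_density r hr0 s).mul (hmeas r hr0)).aestronglyMeasurable
    · exact (hflow.integrable_density hU hμ ht.le s).mul_bdd (c := B)
        (hmeas t ht.le).aestronglyMeasurable (ae_of_all _ fun a => (hB' t htI a).2)
    · exact ((hflow.continuous_deriv ht s).measurable.mul
        ((hmeas t ht.le).add_const 1)).aestronglyMeasurable
    · rw [norm_mul]
      refine mul_le_mul (h r hr a) ?_ (abs_nonneg _) ((abs_nonneg _).trans (h r hr a))
      refine (abs_add_le _ _).trans ?_
      rw [abs_one]
      linarith [(hB' r hr a).2]
    · have h1 := (hflow.differentiable_time r (by linarith [hr.1]) s a).hasDerivAt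
      have hne := (hB' r hr a).1.ne'
      have h2 := h1.mul ((h1.log hne).add_const (U a))
      convert! h2 using 1
      field_simp
  convert! hmain using 1
  have hI : Integrable fun a => deriv (fun r => p r s a) t * (Real.log (p t s a) + U a) :=
    (hflow.integrable_deriv ht s).mul_bdd (c := B)
      (hmeas t ht.le).aestronglyMeasurable (ae_of_all _ fun a => (hB' t htI a).2)
  simp_rw [mul_add_one]
  rw [integral_add hI (hflow.integrable_deriv ht s), hflow.integral_deriv_eq_zero hU hμ ht s,
    add_zero]

lemma IsRegularFlow.tendsto_integral_zero (s : S)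
    {G : ℝ → EuclideanSpace ℝ (Fin d) → ℝ} {L : ℝ}
    (hint : ∀ r, 0 ≤ r → r ≤ 1 → Integrable (G r))
    (hG : ∀ r, 0 < r → r ≤ 1 → ∀ᵐ a, |G r a - G 0 a| ≤ L * |p r s a - p 0 s a|) :
    Tendsto (fun r => ∫ a, G r a) (𝓝[>] 0) (𝓝 (∫ a, G 0 a)) := by
  have h1 : Tendsto (fun r => ∫ a, |p r s a - p 0 s a|) (𝓝[>] 0) (𝓝 0) := by
    have h := (ENNReal.tendsto_toReal ENNReal.zero_ne_top).comp (hflow.initial s)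
    rw [ENNReal.toReal_zero] at h
    refine h.congr' ?_
    filter_upwards [self_mem_nhdsWithin] with r hr
    have hsub : Integrable fun a => p r s a - p 0 s a :=
      (hflow.integrable_density hU hμ (le_of_lt hr) s).sub
        (hflow.integrable_density hU hμ le_rfl s)
    exact (integral_norm_eq_lintegral_enorm hsub.aestronglyMeasurable).symm
  have h2 := h1.const_mul L
  rw [mul_zero] at h2
  refine tendsto_sub_nhds_zero_iff.1 (squeeze_zero_norm' ?_ h2)
  filter_upwards [Ioc_mem_nhdsGT (zero_lt_one' ℝ)] with r hr
  rw [← integral_sub (hint r hr.1.le hr.2) (hint 0 le_rfl zero_le_one), ← integral_const_mul]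
  refine norm_integral_le_of_norm_le ?_ (hG r hr.1 hr.2)
  exact (((hflow.integrable_density hU hμ hr.1.le s).sub
        (hflow.integrable_density hU hμ le_rfl s)).abs).const_mul L

lemma IsRegularFlow.tendsto_integral_mul_zero (s : S)
    {φ : EuclideanSpace ℝ (Fin d) → ℝ} (hφ : Measurable φ) {C : ℝ} (hC : ∀ a, |φ a| ≤ C) :
    Tendsto (fun r => ∫ a, p r s a * φ a) (𝓝[>] 0) (𝓝 (∫ a, p 0 s a * φ a)) := by
  refine hflow.tendsto_integral_zero hU hμ s (G := fun r a => p r s a * φ a) (L := C)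
    (fun r hr _ => ?_) fun r hr _ => ae_of_all _ fun a => ?_
  · exact (hflow.integrable_density hU hμ hr s).mul_bdd (c := C) hφ.aestronglyMeasurable
      (ae_of_all _ hC)
  · rw [← sub_mul, abs_mul, mul_comm]
    exact mul_le_mul_of_nonneg_right (hC a) (abs_nonneg _)

lemma IsRegularFlow.tendsto_entropy_zero (s : S) :
    Tendsto (fun r => ∫ a, p r s a * (Real.log (p r s a) + U a)) (𝓝[>] 0)
      (𝓝 (∫ a, p 0 s a * (Real.log (p 0 s a) + U a))) := by
  obtain ⟨B, hB⟩ := hflow.exists_ae_bound hU hμ 1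
  refine hflow.tendsto_integral_zero hU hμ s
    (G := fun r a => p r s a * (Real.log (p r s a) + U a)) (L := B + 1)
    (fun r hr hr1 => ?_) fun r hr hr1 => ?_
  · refine (hflow.integrable_density hU hμ hr s).mul_bdd (c := B)
      ((hflow.measurable_density r hr s).log.add hU.measurable).aestronglyMeasurable ?_
    filter_upwards [hB r hr hr1 s] with a ha using ha.2
  · filter_upwards [hB r hr.le hr1 s, hB 0 le_rfl zero_le_one s] with a h1 h2
    exact abs_mul_log_add_sub_le h1.1 h2.1 h1.2 h2.2

end TimeDerivative

/-! ### Energy dissipation -/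

section Dissipation

variable {d : ℕ}

lemma gradient_apply_eq_fderiv (f : EuclideanSpace ℝ (Fin d) → ℝ) (a : EuclideanSpace ℝ (Fin d))
    (i : Fin d) : gradient f a i = fderiv ℝ f a (EuclideanSpace.single i 1) := by
  rw [← inner_gradient_left, EuclideanSpace.inner_single_right]
  simp

lemma differentiable_gradient {f : EuclideanSpace ℝ (Fin d) → ℝ} (hf : ContDiff ℝ 2 f) :
    Differentiable ℝ (gradient f) := by
  have h1 : Differentiable ℝ (fderiv ℝ f) :=
    (hf.fderiv_right (m := 1) (by norm_num)).differentiable one_ne_zero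
  intro a
  rw [differentiableAt_euclidean]
  intro i
  simp_rw [gradient_apply_eq_fderiv]
  exact (h1 a).clm_apply (differentiableAt_const _)

lemma vectorDiv_gradient {f : EuclideanSpace ℝ (Fin d) → ℝ} (hf : ContDiff ℝ 2 f)
    (a : EuclideanSpace ℝ (Fin d)) : vectorDiv (gradient f) a = Laplacian.laplacian f a := by
  have h1 : Differentiable ℝ (fderiv ℝ f) :=
    (hf.fderiv_right (m := 1) (by norm_num)).differentiable one_ne_zero
  rw [InnerProductSpace.laplacian_eq_iteratedFDeriv_orthonormalBasis f
    (EuclideanSpace.basisFun (Fin d) ℝ)]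
  refine Finset.sum_congr rfl fun i _ => ?_
  rw [iteratedFDeriv_two_apply]
  have h2 : HasFDerivAt (fun x => gradient f x i)
      ((EuclideanSpace.proj i).comp (fderiv ℝ (gradient f) a)) a :=
    (EuclideanSpace.proj (𝕜 := ℝ) i).hasFDerivAt.comp a (differentiable_gradient hf a).hasFDerivAt
  have h3 : HasFDerivAt (fun x => gradient f x i)
      ((fderiv ℝ (fderiv ℝ f) a).flip (EuclideanSpace.single i 1)) a := by
    simp_rw [gradient_apply_eq_fderiv]
    have := (h1 a).hasFDerivAt.clm_apply (hasFDerivAt_const (EuclideanSpace.single i (1 : ℝ)) a)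
    simpa using this
  have h4 := congrArg (fun L => L (EuclideanSpace.single i (1 : ℝ))) (h2.unique h3)
  simpa using h4

lemma vectorDiv_add_smul {F G : EuclideanSpace ℝ (Fin d) → EuclideanSpace ℝ (Fin d)}
    {a : EuclideanSpace ℝ (Fin d)} (c : ℝ) (hF : DifferentiableAt ℝ F a)
    (hG : DifferentiableAt ℝ G a) :
    vectorDiv (fun x => F x + c • G x) a = vectorDiv F a + c * vectorDiv G a := by
  have hG' : DifferentiableAt ℝ (fun x => c • G x) a := hG.const_smul c
  unfold vectorDiv
  rw [fderiv_fun_add hF hG', fderiv_fun_const_smul hG, Finset.mul_sum,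
    ← Finset.sum_add_distrib]
  refine Finset.sum_congr rfl fun i _ => ?_
  simp

variable {U : EuclideanSpace ℝ (Fin d) → ℝ} {S : Type*} [MeasurableSpace S]
  {M : MDP S (EuclideanSpace ℝ (Fin d))} {τ : ℝ}
  {π : ℝ → Kernel S (EuclideanSpace ℝ (Fin d))} [∀ t, IsMarkovKernel (π t)]
  {p : ℝ → S → EuclideanSpace ℝ (Fin d) → ℝ}

/-- The first variation `ψ = Q^{π_t} + τ ln (dπ_t / dμ)` of the regularised one-step problem.
Up to a constant it is `τ ln (dπ_t / dΦ[π_t])`. -/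
noncomputable def firstVariation (M : MDP S (EuclideanSpace ℝ (Fin d))) (τ : ℝ)
    (U : EuclideanSpace ℝ (Fin d) → ℝ) (π : ℝ → Kernel S (EuclideanSpace ℝ (Fin d)))
    [∀ t, IsMarkovKernel (π t)] (p : ℝ → S → EuclideanSpace ℝ (Fin d) → ℝ) (t : ℝ) (s : S)
    (a : EuclideanSpace ℝ (Fin d)) : ℝ :=
  M.Q τ (refMeasure U) (π t) s a + τ * (Real.log (p t s a) + U a)

/-- The rate `-∫ ψ ∂_t p` at which the flow decreases the regularised one-step cost at `s`. -/
noncomputable def dissipation (M : MDP S (EuclideanSpace ℝ (Fin d))) (τ : ℝ)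
    (U : EuclideanSpace ℝ (Fin d) → ℝ) (π : ℝ → Kernel S (EuclideanSpace ℝ (Fin d)))
    [∀ t, IsMarkovKernel (π t)] (p : ℝ → S → EuclideanSpace ℝ (Fin d) → ℝ) (t : ℝ) (s : S) : ℝ :=
  -∫ a, firstVariation M τ U π p t s a * deriv (fun r => p r s a) t

variable (hflow : IsRegularFlow M τ U π p) (hU : Differentiable ℝ U)
  (hμ : IsProbabilityMeasure (refMeasure U))

include hflow hU hμ

lemma IsRegularFlow.differentiable_firstVariation {t : ℝ} (ht : 0 < t) (s : S) :
    Differentiable ℝ (firstVariation M τ U π p t s) := by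
  obtain ⟨B, hB⟩ := hflow.exists_bound hU.continuous hμ t
  have hp := (hflow.contDiff_space t ht s).differentiable two_ne_zero
  exact (hflow.differentiable_Q t ht s).add
    (((hp.log fun a => (hB t ht le_rfl s a).1.ne').add hU).const_mul τ)

/-- The flux of the equation is `p ∇ψ`. -/
lemma IsRegularFlow.smul_gradient_firstVariation {t : ℝ} (ht : 0 < t) (s : S)
    (a : EuclideanSpace ℝ (Fin d)) :
    p t s a • gradient (firstVariation M τ U π p t s) a =
      (p t s a • gradient (M.Q τ (refMeasure U) (π t) s) a + (τ * p t s a) • gradient U a) +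
        τ • gradient (p t s) a := by
  obtain ⟨B, hB⟩ := hflow.exists_bound hU.continuous hμ t
  have hne := (hB t ht le_rfl s a).1.ne'
  have hp := (hflow.contDiff_space t ht s).differentiable two_ne_zero a
  have hQ := hflow.differentiable_Q t ht s a
  have h : HasFDerivAt (firstVariation M τ U π p t s) (fderiv ℝ (M.Q τ (refMeasure U) (π t) s) a +
      τ • ((p t s a)⁻¹ • fderiv ℝ (p t s) a + fderiv ℝ U a)) a :=
    hQ.hasFDerivAt.add (((hp.hasFDerivAt.log hne).add (hU a).hasFDerivAt).const_mul τ)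
  ext i
  simp only [PiLp.add_apply, PiLp.smul_apply, smul_eq_mul, gradient_apply_eq_fderiv, h.fderiv,
    add_apply, smul_apply]
  field_simp
  ring

lemma IsRegularFlow.differentiable_flux {t : ℝ} (ht : 0 < t) (s : S) :
    Differentiable ℝ fun a => p t s a • gradient (firstVariation M τ U π p t s) a := by
  simp_rw [hflow.smul_gradient_firstVariation hU hμ ht s]
  exact (hflow.differentiable_drift t ht s).add
    ((differentiable_gradient (hflow.contDiff_space t ht s)).const_smul τ)

lemma IsRegularFlow.vectorDiv_flux {t : ℝ} (ht : 0 < t) (s : S) :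
    (vectorDiv fun a => p t s a • gradient (firstVariation M τ U π p t s) a) =
      fun a => deriv (fun r => p r s a) t := by
  have hp := hflow.contDiff_space t ht s
  ext a
  simp_rw [hflow.smul_gradient_firstVariation hU hμ ht s]
  rw [vectorDiv_add_smul τ (hflow.differentiable_drift t ht s a) (differentiable_gradient hp a),
    vectorDiv_gradient hp, hflow.equation t ht s a]

/-- Although `∇Q` and `∇U` need not be continuous, `∇ψ` is: it is the flux divided by `p`. -/
lemma IsRegularFlow.contDiff_firstVariation {t : ℝ} (ht : 0 < t) (s : S) :
    ContDiff ℝ 1 (firstVariation M τ U π p t s) := by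
  obtain ⟨B, hB⟩ := hflow.exists_bound hU.continuous hμ t
  have hp := (hflow.contDiff_space t ht s).continuous
  have h1 : gradient (firstVariation M τ U π p t s) = fun a =>
      (p t s a)⁻¹ • (p t s a • gradient (firstVariation M τ U π p t s) a) := by
    ext1 a
    rw [smul_smul, inv_mul_cancel₀ (hB t ht le_rfl s a).1.ne', one_smul]
  have h2 : Continuous (gradient (firstVariation M τ U π p t s)) := by
    rw [h1]
    exact (hp.inv₀ fun a => (hB t ht le_rfl s a).1.ne').smul
      (hflow.differentiable_flux hU hμ ht s).continuous
  rw [contDiff_one_iff_fderiv]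
  refine ⟨hflow.differentiable_firstVariation hU hμ ht s, ?_⟩
  rw [← toDual_comp_gradient]
  exact (InnerProductSpace.toDual ℝ (EuclideanSpace ℝ (Fin d))).continuous.comp h2

variable [Fintype S]

lemma IsRegularFlow.exists_firstVariation_bound {t : ℝ} (ht : 0 < t) (s : S) :
    ∃ K, ∀ a, |firstVariation M τ U π p t s a| ≤ K := by
  obtain ⟨B, hB⟩ := hflow.exists_bound hU.continuous hμ t
  obtain ⟨K, hK⟩ := M.exists_abs_Q_le τ (refMeasure U) (π t)
  refine ⟨K + |τ| * B, fun a => (abs_add_le _ _).trans (add_le_add (hK s a) ?_)⟩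
  rw [abs_mul]
  exact mul_le_mul_of_nonneg_left (hB t ht le_rfl s a).2 (abs_nonneg τ)

/-- Energy dissipation: `∫ |∇ψ|² dπ_t ≤ -∫ ψ ∂_t p`. -/
lemma IsRegularFlow.lintegral_gradient_sq_le {t : ℝ} (ht : 0 < t) (s : S) :
    0 ≤ dissipation M τ U π p t s ∧
      ∫⁻ a, ‖gradient (firstVariation M τ U π p t s) a‖ₑ ^ 2 ∂(π t s) ≤
        ENNReal.ofReal (dissipation M τ U π p t s) := by
  obtain ⟨B, hB⟩ := hflow.exists_bound hU.continuous hμ t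
  obtain ⟨K, hK⟩ := hflow.exists_firstVariation_bound hU hμ ht s
  have hψ := hflow.contDiff_firstVariation hU hμ ht s
  have hg : Continuous (gradient (firstVariation M τ U π p t s)) :=
    (InnerProductSpace.toDual ℝ (EuclideanSpace ℝ (Fin d))).symm.continuous.comp
      (hψ.continuous_fderiv one_ne_zero)
  have hdiv := hflow.vectorDiv_flux hU hμ ht s
  have h := lintegral_norm_gradient_sq_le hψ hK (hflow.contDiff_space t ht s).continuous
    (fun a => (hB t ht le_rfl s a).1.le) (hflow.integrable_density hU.continuous hμ ht.le s)
    (hflow.differentiable_flux hU hμ ht s) (by rw [hdiv]; exact hflow.continuous_deriv ht s)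
    (by rw [hdiv]; exact hflow.integrable_deriv ht s)
  rw [hdiv] at h
  refine ⟨h.1, ?_⟩
  rw [hflow.density t ht.le s, lintegral_withDensity_eq_lintegral_mul _
    (hflow.measurable_density t ht.le s).ennreal_ofReal (hg.measurable.enorm.pow_const 2)]
  refine le_trans (le_of_eq (lintegral_congr fun a => ?_)) h.2
  rw [Pi.mul_apply, mul_comm]

variable [MeasurableSingletonClass S]

/-- The log-Sobolev inequality along the flow bounds the relative entropy with respect to the
proximal policy by the dissipation. -/
lemma IsRegularFlow.klDiv_proximal_le (hτ : 0 < τ) {α : ℝ} (hα : 0 < α)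
    (hLS : LogSobolevAlongFlow M τ (refMeasure U) π α) {t : ℝ} (ht : 0 < t) (s : S) :
    2 * α * τ ^ 2 * (klDiv (π t s)
      ((refMeasure U).tilted fun a => -M.Q τ (refMeasure U) (π t) s a / τ)).toReal ≤
        dissipation M τ U π p t s := by
  obtain ⟨B, hB⟩ := hflow.exists_bound hU.continuous hμ t
  obtain ⟨K, hK⟩ := M.exists_abs_Q_le τ (refMeasure U) (π t)
  have hQm := M.measurable_Q τ (refMeasure U) (π t) s
  have hQmτ : Measurable fun a => -M.Q τ (refMeasure U) (π t) s a / τ := by fun_prop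
  have hint := integrable_exp_of_bound (μ := refMeasure U) hQmτ (B := K / τ) fun a => by
    rw [abs_div, abs_neg, abs_of_pos hτ]
    exact div_le_div_of_nonneg_right (hK s a) hτ.le
  set Z := Real.log (∫ x, Real.exp (-M.Q τ (refMeasure U) (π t) s x / τ) ∂(refMeasure U)) with hZ
  set ψ := firstVariation M τ U π p t s with hψ
  have hψC : ContDiff ℝ 1 ψ := hflow.contDiff_firstVariation hU hμ ht s
  have hψm : Measurable ψ := hψC.continuous.measurable
  have hUm := hU.continuous.measurable
  have hdens : π t s = ((refMeasure U).tilted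
      fun a => -M.Q τ (refMeasure U) (π t) s a / τ).withDensity
        fun a => ENNReal.ofReal (Real.exp (ψ a / τ + Z)) := by
    rw [tilted_eq_withDensity_exp _ hint, refMeasure_withDensity hU.continuous (by fun_prop),
      ← withDensity_mul _ (by fun_prop) (by fun_prop), hflow.density t ht.le s]
    congr 1 with a
    rw [Pi.mul_apply, ← ENNReal.ofReal_mul (Real.exp_pos _).le, ← Real.exp_add]
    congr 1
    rw [← hZ, hψ, firstVariation]
    have : -M.Q τ (refMeasure U) (π t) s a / τ - Z - U a +
        ((M.Q τ (refMeasure U) (π t) s a + τ * (Real.log (p t s a) + U a)) / τ + Z) =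
        Real.log (p t s a) := by
      field_simp
      ring
    rw [this, Real.exp_log (hB t ht le_rfl s a).1]
  have h := hLS t ht s _ ((M.isProximal_iff hτ (refMeasure U) (π t) s _).2 rfl)
    (fun a => Real.exp (ψ a / τ + Z)) ((hψC.div_const τ).add contDiff_const).exp
    (fun a => Real.exp_pos _) hdens
  have hgrad : ∀ a, gradient (fun x => Real.log (Real.exp (ψ x / τ + Z))) a =
      τ⁻¹ • gradient ψ a := fun a => by
    have h1 : HasFDerivAt (fun x => ψ x / τ + Z) (τ⁻¹ • fderiv ℝ ψ a) a := by
      have h2 := ((hψC.differentiable one_ne_zero a).hasFDerivAt.const_smul τ⁻¹).add_const Z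
      refine h2.congr_of_eventuallyEq (Eventually.of_forall fun x => ?_)
      simp only [Pi.smul_apply, smul_eq_mul]
      ring
    simp_rw [Real.log_exp]
    ext i
    rw [PiLp.smul_apply, gradient_apply_eq_fderiv, gradient_apply_eq_fderiv, h1.fderiv]
    rfl
  obtain ⟨hD0, hD⟩ := hflow.lintegral_gradient_sq_le hU hμ ht s
  have h3 : klDiv (π t s) ((refMeasure U).tilted
      fun a => -M.Q τ (refMeasure U) (π t) s a / τ) ≤
      ENNReal.ofReal (1 / (2 * α) * ((τ⁻¹) ^ 2 * dissipation M τ U π p t s)) := by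
    refine h.trans ?_
    rw [ENNReal.ofReal_mul (by positivity), ENNReal.ofReal_mul (by positivity)]
    simp_rw [hgrad, enorm_smul, mul_pow]
    rw [lintegral_const_mul' _ _ (by simp), ENNReal.ofReal_pow (by positivity),
      ← Real.enorm_of_nonneg (inv_nonneg.2 hτ.le)]
    gcongr
  have h4 := ENNReal.toReal_le_of_le_ofReal (by positivity) h3
  calc _ ≤ 2 * α * τ ^ 2 * (1 / (2 * α) * ((τ⁻¹) ^ 2 * dissipation M τ U π p t s)) := by gcongr
    _ = _ := by field_simp

end Dissipation

/-! ### The value functions along the flow -/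

section ValueAlongFlow

lemma le_mul_exp_of_deriv_le {G G' : ℝ → ℝ} {c : ℝ} (h0 : Tendsto G (𝓝[>] 0) (𝓝 (G 0)))
    (hG : ∀ t, 0 < t → HasDerivAt G (G' t) t) (hle : ∀ t, 0 < t → G' t ≤ -(c * G t)) {t : ℝ}
    (ht : 0 ≤ t) : G t ≤ G 0 * Real.exp (-(c * t)) := by
  have hexp : ∀ t : ℝ, HasDerivAt (fun t => Real.exp (c * t)) (Real.exp (c * t) * c) t := fun t => by
    have := ((hasDerivAt_id t).const_mul c).exp
    simpa using this
  have hd : ∀ t, 0 < t → HasDerivAt (fun t => G t * Real.exp (c * t))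
      (G' t * Real.exp (c * t) + G t * (Real.exp (c * t) * c)) t := fun t ht => (hG t ht).mul (hexp t)
  have hanti : AntitoneOn (fun t => G t * Real.exp (c * t)) (Set.Ici 0) := by
    refine antitoneOn_of_deriv_nonpos (convex_Ici 0) (fun t ht => ?_) (fun t ht => ?_) fun t ht => ?_
    · rcases (Set.mem_Ici.1 ht).eq_or_lt with rfl | h
      · exact (continuousWithinAt_Ioi_iff_Ici.1 h0).mul (hexp 0).continuousAt.continuousWithinAt
      · exact (hd t h).continuousAt.continuousWithinAt
    · rw [interior_Ici] at ht
      exact (hd t ht).differentiableAt.differentiableWithinAt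
    · rw [interior_Ici] at ht
      rw [(hd t ht).deriv]
      have := mul_le_mul_of_nonneg_right (hle t ht) (Real.exp_pos (c * t)).le
      linarith
  have h := hanti (Set.mem_Ici.2 le_rfl) (Set.mem_Ici.2 ht) ht
  simp only [mul_zero, Real.exp_zero, mul_one] at h
  rw [Real.exp_neg, ← div_eq_mul_inv, le_div_iff₀ (Real.exp_pos _)]
  exact h

variable {d : ℕ} {U : EuclideanSpace ℝ (Fin d) → ℝ}
  {S : Type*} [Fintype S] [MeasurableSpace S] [MeasurableSingletonClass S]
  {M : MDP S (EuclideanSpace ℝ (Fin d))} {τ : ℝ}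
  {π : ℝ → Kernel S (EuclideanSpace ℝ (Fin d))} [∀ t, IsMarkovKernel (π t)]
  {p : ℝ → S → EuclideanSpace ℝ (Fin d) → ℝ}

lemma MDP.exists_integral_P_bound (M : MDP S (EuclideanSpace ℝ (Fin d))) (f : S → ℝ) (s : S) :
    Measurable (fun a => ∫ x, f x ∂(M.P (s, a))) ∧ ∃ C, ∀ a, |∫ x, f x ∂(M.P (s, a))| ≤ C := by
  obtain ⟨C, hC⟩ := MDP.exists_abs_le_of_fintype f
  have hf : StronglyMeasurable f := (measurable_of_finite f).stronglyMeasurable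
  exact ⟨hf.integral_kernel.measurable.comp measurable_prodMk_left,
    C, fun a => MDP.abs_integral_le_of_bound _ hC⟩

variable (hflow : IsRegularFlow M τ U π p) (hU : Differentiable ℝ U)
  (hμ : IsProbabilityMeasure (refMeasure U))

include hflow hU hμ

lemma IsRegularFlow.integral_stateKernel_eq {t : ℝ} (ht : 0 ≤ t) (s : S) (f : S → ℝ) :
    ∫ x, f x ∂(M.stateKernel (π t) s) = ∫ a, p t s a * ∫ x, f x ∂(M.P (s, a)) := by
  rw [M.integral_stateKernel, hflow.integral_eq hU.continuous hμ ht]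

omit [Fintype S] [MeasurableSingletonClass S] in
lemma IsRegularFlow.stageCost_eq {t : ℝ} (ht : 0 ≤ t) (s : S) :
    M.stageCost τ (refMeasure U) (π t) s = (∫ a, p t s a * M.c (s, a)) +
      τ * ∫ a, p t s a * (Real.log (p t s a) + U a) := by
  rw [MDP.stageCost, hflow.integral_eq hU.continuous hμ ht, hflow.toReal_klDiv hU.continuous hμ ht]

lemma IsRegularFlow.value_eq (hτ : 0 ≤ τ) {t : ℝ} (ht : 0 ≤ t) (s : S) :
    M.value τ (refMeasure U) (π t) s = M.stageCost τ (refMeasure U) (π t) s +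
      M.γ * ∫ x, M.value τ (refMeasure U) (π t) x ∂(M.stateKernel (π t) s) :=
  M.value_eq_stageCost_add hτ _ _ (fun s => hflow.klDiv_ne_top hU.continuous hμ ht s) s

/-- The one-step derivative: with the continuation value frozen at `V^{π_t}`, the expected cost of
`π_r` has derivative `∫ ψ ∂_t p` at `r = t`. -/
lemma IsRegularFlow.hasDerivAt_frozen {t : ℝ} (ht : 0 < t) (s : S) :
    HasDerivAt (fun r => M.stageCost τ (refMeasure U) (π r) s +
      M.γ * ∫ x, M.value τ (refMeasure U) (π t) x ∂(M.stateKernel (π r) s))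
      (-dissipation M τ U π p t s) t := by
  obtain ⟨K, hK⟩ := M.exists_abs_Q_le τ (refMeasure U) (π t)
  obtain ⟨B, hB⟩ := hflow.exists_bound hU.continuous hμ t
  have hQm := M.measurable_Q τ (refMeasure U) (π t) s
  have h1 := hflow.hasDerivAt_integral_mul hU.continuous hμ ht s hQm (hK s)
  have h2 := (hflow.hasDerivAt_entropy hU.continuous hμ ht s).const_mul τ
  have hint := hflow.integrable_deriv ht s
  have hI1 : Integrable fun a =>
      deriv (fun r => p r s a) t * M.Q τ (refMeasure U) (π t) s a :=
    hint.mul_bdd (c := K) hQm.aestronglyMeasurable (ae_of_all _ (hK s))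
  have hI2 : Integrable fun a =>
      deriv (fun r => p r s a) t * (Real.log (p t s a) + U a) :=
    hint.mul_bdd (c := B) ((hflow.measurable_density t ht.le s).log.add
      hU.continuous.measurable).aestronglyMeasurable
        (ae_of_all _ fun a => (hB t ht le_rfl s a).2)
  have hval : -dissipation M τ U π p t s =
      ∫ a, deriv (fun r => p r s a) t * M.Q τ (refMeasure U) (π t) s a +
        τ * (deriv (fun r => p r s a) t * (Real.log (p t s a) + U a)) := by
    rw [dissipation, neg_neg]
    refine integral_congr_ae (ae_of_all _ fun a => ?_)
    simp only [firstVariation]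
    ring
  rw [hval, integral_add hI1 (hI2.const_mul τ), integral_const_mul]
  refine (h1.add h2).congr_of_eventuallyEq ?_
  filter_upwards [Ioi_mem_nhds ht] with r hr
  have hQ := M.integral_Q τ (refMeasure U) (π t) (π r) s
  rw [hflow.integral_eq hU.continuous hμ (le_of_lt hr)] at hQ
  rw [Pi.add_apply, hQ, MDP.stageCost, hflow.toReal_klDiv hU.continuous hμ (le_of_lt hr)]
  ring

/-- The value functions are differentiable along the flow, and decrease at least at the rate of the
dissipation, since `(1 - γ P)⁻¹ ≥ 1` on nonnegative functions. -/
lemma IsRegularFlow.exists_hasDerivAt_value (hτ : 0 ≤ τ) {t : ℝ} (ht : 0 < t) :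
    ∃ w : S → ℝ, ∀ s, HasDerivAt (fun r => M.value τ (refMeasure U) (π r) s) (w s) t ∧
      w s ≤ -dissipation M τ U π p t s := by
  obtain ⟨w, hw, hweq⟩ := hasDerivAt_fixedPoint (fun r => M.stateKernel (π r)) M.γ_nonneg
    M.γ_lt_one (g := fun r => M.stageCost τ (refMeasure U) (π r))
    (v := fun r => M.value τ (refMeasure U) (π r)) (t := t)
    (f := fun s => -dissipation M τ U π p t s)
    (by
      filter_upwards [Ioi_mem_nhds ht] with r hr s
      exact hflow.value_eq hU hμ hτ (le_of_lt hr) s)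
    (fun f s => by
      obtain ⟨hm, C, hC⟩ := M.exists_integral_P_bound f s
      refine (hflow.hasDerivAt_integral_mul hU.continuous hμ ht s hm hC).continuousAt.congr ?_
      filter_upwards [Ioi_mem_nhds ht] with r hr
      exact (hflow.integral_stateKernel_eq hU hμ (le_of_lt hr) s f).symm)
    (fun s => hflow.hasDerivAt_frozen hU hμ ht s)
  have hD : ∀ s, 0 ≤ dissipation M τ U π p t s := fun s =>
    (hflow.lintegral_gradient_sq_le hU hμ ht s).1
  have hw0 : ∀ s, w s ≤ 0 := fun s => by
    have := le_div_of_le_add_integral (M.stateKernel (π t)) M.γ_nonneg M.γ_lt_one (y := w) (ε := 0)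
      (fun s => by linarith [hweq s, hD s]) s
    rwa [zero_div] at this
  refine ⟨w, fun s => ⟨hw s, ?_⟩⟩
  have := mul_nonpos_of_nonneg_of_nonpos M.γ_nonneg
    (integral_nonpos (μ := M.stateKernel (π t) s) hw0)
  linarith [hweq s]

lemma IsRegularFlow.tendsto_value_zero (hτ : 0 ≤ τ) (s : S) :
    Tendsto (fun r => M.value τ (refMeasure U) (π r) s) (𝓝[>] 0)
      (𝓝 (M.value τ (refMeasure U) (π 0) s)) := by
  refine tendsto_fixedPoint (fun r => M.stateKernel (π r)) M.γ_nonneg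
    M.γ_lt_one (g := fun r => M.stageCost τ (refMeasure U) (π r))
    (v := fun r => M.value τ (refMeasure U) (π r)) (t := 0) ?_ (fun s => ?_) s
  · filter_upwards [self_mem_nhdsWithin] with r hr s
    exact hflow.value_eq hU hμ hτ (le_of_lt hr) s
  · obtain ⟨C, hC⟩ := M.bounded_c
    obtain ⟨hm, K, hK⟩ := M.exists_integral_P_bound (M.value τ (refMeasure U) (π 0)) s
    have h1 := hflow.tendsto_integral_mul_zero hU.continuous hμ s
      (M.measurable_c.comp measurable_prodMk_left) fun a => hC (s, a)
    have h2 := (hflow.tendsto_entropy_zero hU.continuous hμ s).const_mul τ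
    have h3 := (hflow.tendsto_integral_mul_zero hU.continuous hμ s hm hK).const_mul M.γ
    rw [hflow.value_eq hU hμ hτ le_rfl s, hflow.stageCost_eq hU hμ le_rfl,
      hflow.integral_stateKernel_eq hU hμ le_rfl]
    refine ((h1.add h2).add h3).congr' ?_
    filter_upwards [self_mem_nhdsWithin] with r hr
    rw [hflow.stageCost_eq hU hμ (le_of_lt hr),
      hflow.integral_stateKernel_eq hU hμ (le_of_lt hr)]
    rfl

/-- The value functions decrease along the flow. -/
lemma IsRegularFlow.value_le_value_zero (hτ : 0 ≤ τ) {t : ℝ} (ht : 0 ≤ t) (s : S) :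
    M.value τ (refMeasure U) (π t) s ≤ M.value τ (refMeasure U) (π 0) s := by
  have hd : ∀ t, 0 < t → ∃ w, HasDerivAt (fun r => M.value τ (refMeasure U) (π r) s) w t ∧ w ≤ 0 :=
    fun t ht => by
      obtain ⟨w, hw⟩ := hflow.exists_hasDerivAt_value hU hμ hτ ht
      exact ⟨w s, (hw s).1,
        (hw s).2.trans (neg_nonpos.2 (hflow.lintegral_gradient_sq_le hU hμ ht s).1)⟩
  have h := le_mul_exp_of_deriv_le (c := 0) (hflow.tendsto_value_zero hU hμ hτ s)
    (G' := fun t => deriv (fun r => M.value τ (refMeasure U) (π r) s) t) (fun t ht => by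
      obtain ⟨w, hw, -⟩ := hd t ht
      exact hw.differentiableAt.hasDerivAt) (fun t ht => by
      obtain ⟨w, hw, hw0⟩ := hd t ht
      rw [hw.deriv, zero_mul, neg_zero]
      exact hw0) ht
  simpa using h

/-- The `Q`-functions are bounded uniformly along the flow: the values decrease, and they are
bounded below because relative entropies are nonnegative. -/
lemma IsRegularFlow.exists_abs_Q_le_uniform (hτ : 0 ≤ τ) :
    ∃ K, ∀ t, 0 ≤ t → ∀ s a, |M.Q τ (refMeasure U) (π t) s a| ≤ K := by
  obtain ⟨C, hC⟩ := M.bounded_c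
  obtain ⟨K, hK⟩ := MDP.exists_abs_le_of_fintype (M.value τ (refMeasure U) (π 0))
  refine ⟨C + M.γ * (max K (C / (1 - M.γ))), fun t ht => M.abs_Q_le τ _ _ hC fun s =>
    abs_le'.2 ⟨?_, ?_⟩⟩
  · exact ((hflow.value_le_value_zero hU hμ hτ ht s).trans (le_of_abs_le (hK s))).trans
      (le_max_left _ _)
  · refine le_trans ?_ (le_max_right _ _)
    refine le_div_of_le_add_integral (M.stateKernel (π t)) M.γ_nonneg M.γ_lt_one
      (y := fun s => -M.value τ (refMeasure U) (π t) s) (fun s => ?_) s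
    have h1 := hflow.value_eq hU hμ hτ ht s
    have h2 := neg_le_of_abs_le
      (MDP.abs_integral_le_of_bound (π t s) (f := fun a => M.c (s, a)) fun a => hC (s, a))
    have h3 := mul_nonneg hτ (ENNReal.toReal_nonneg (a := klDiv (π t s) (refMeasure U)))
    rw [MDP.stageCost] at h1
    rw [integral_neg]
    linarith

/-- The log-Sobolev inequality of the reference measure passes to all proximal policies along the
flow, with a constant that does not depend on time. -/
lemma IsRegularFlow.exists_logSobolevAlongFlow (hτ : 0 < τ)
    (hLSI : ∃ α₀ : ℝ, 0 < α₀ ∧ LogSobolev α₀ (refMeasure U)) :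
    ∃ α : ℝ, 0 < α ∧ LogSobolevAlongFlow M τ (refMeasure U) π α := by
  obtain ⟨α₀, hα₀, hLS⟩ := hLSI
  obtain ⟨K, hK⟩ := hflow.exists_abs_Q_le_uniform hU hμ hτ.le
  refine ⟨α₀ / Real.exp (2 * (K / τ)) ^ 2, by positivity, fun t ht s m hm => ?_⟩
  rw [M.isProximal_iff hτ] at hm
  have hQm := M.measurable_Q τ (refMeasure U) (π t) s
  have hf : Measurable fun a => -M.Q τ (refMeasure U) (π t) s a / τ := by fun_prop
  have hB : ∀ a, |-M.Q τ (refMeasure U) (π t) s a / τ| ≤ K / τ := fun a => by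
    rw [abs_div, abs_neg, abs_of_pos hτ]
    exact div_le_div_of_nonneg_right (hK t ht.le s a) hτ.le
  have hint := integrable_exp_of_bound (μ := refMeasure U) hf hB
  have hprob : IsProbabilityMeasure m := hm ▸ isProbabilityMeasure_tilted hint
  rw [tilted_eq_withDensity_exp _ hint] at hm
  rw [hm] at hprob ⊢
  refine hLS.withDensity (by fun_prop) (Real.exp_pos _) (fun a => ?_) (fun a => ?_) (π t s)
    inferInstance
  · rw [← Real.exp_neg]
    exact Real.exp_le_exp.2 (neg_le_of_abs_le (abs_sub_log_integral_exp_le hf hB a))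
  · exact Real.exp_le_exp.2 (le_of_abs_le (abs_sub_log_integral_exp_le hf hB a))

end ValueAlongFlow

/-! ### Convergence to the optimal value -/

section Convergence

variable {S : Type*} [Fintype S] [MeasurableSpace S] [MeasurableSingletonClass S]

namespace MDP

variable {A : Type*} [MeasurableSpace A]

/-- An optimal stationary policy has finite relative entropies, and its value is below that of any
stationary policy with finite relative entropies. -/
lemma IsOptimal.value_le (M : MDP S A) {τ : ℝ} (hτ : 0 < τ) (μ : Measure A)
    {πs : Kernel S A} [IsMarkovKernel πs] (hopt : M.IsOptimal τ μ (Policy.ofKernel πs))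
    (σ : Kernel S A) [IsMarkovKernel σ] (hσ : ∀ s, klDiv (σ s) μ ≠ ⊤) :
    (∀ s, klDiv (πs s) μ ≠ ⊤) ∧ ∀ s, M.value τ μ πs s ≤ M.value τ μ σ s := by
  have hle : ∀ s, M.valueE τ μ (Policy.ofKernel πs) s ≤ ((M.value τ μ σ s : ℝ) : EReal) :=
    fun s => by
      rw [M.coe_value hτ.le μ σ hσ, hopt s]
      exact iInf_le _ _
  have hkl : ∀ s, klDiv (πs s) μ ≠ ⊤ := fun s =>
    M.klDiv_ne_top_of_valueE_ne_top hτ μ πs s ((hle s).trans_lt (EReal.coe_lt_top _)).ne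
  refine ⟨hkl, fun s => ?_⟩
  have h := hle s
  rwa [← M.coe_value hτ.le μ πs hkl, EReal.coe_le_coe_iff] at h

/-- The one-step form of the performance difference: a further policy `σ` improves on `V^π` in one
step by at most `τ KL(π | Φ[π])`. -/
lemma value_sub_le (M : MDP S A) {τ : ℝ} (hτ : 0 < τ) (μ : Measure A) [IsProbabilityMeasure μ]
    (π σ : Kernel S A) [IsMarkovKernel π] [IsMarkovKernel σ] (hπ : ∀ s, klDiv (π s) μ ≠ ⊤)
    (hσ : ∀ s, klDiv (σ s) μ ≠ ⊤) (s : S) :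
    M.value τ μ π s - (M.stageCost τ μ σ s + M.γ * ∫ x, M.value τ μ π x ∂(M.stateKernel σ s)) ≤
      τ * (klDiv (π s) (μ.tilted fun a => -M.Q τ μ π s a / τ)).toReal := by
  obtain ⟨K, hK⟩ := M.exists_abs_Q_le τ μ π
  have hQ := M.measurable_Q τ μ π s
  have h1 := (integral_add_klDiv_eq (μ := μ) hQ (hK s) hτ (π s) (hπ s)).2
  have h2 := (integral_add_klDiv_eq (μ := μ) hQ (hK s) hτ (σ s) (hσ s)).2
  have h3 := M.value_eq_stageCost_add hτ.le μ π hπ s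
  rw [integral_Q] at h1 h2
  rw [stageCost] at h3 ⊢
  have h4 := mul_nonneg hτ.le
    (ENNReal.toReal_nonneg (a := klDiv (σ s) (μ.tilted fun a => -M.Q τ μ π s a / τ)))
  linarith

/-- Integrating `u - γ P_σ u` against the occupancy measure recovers the initial distribution. -/
lemma integral_occupancy_sub (M : MDP S A) (σ : Kernel S A) [IsMarkovKernel σ] (ρ : Measure S)
    [IsProbabilityMeasure ρ] (u : S → ℝ) :
    ∫ s, (u s - M.γ * ∫ x, u x ∂(M.stateKernel σ s)) ∂(M.occupancy σ ρ) =
      (1 - M.γ) * ∫ s, u s ∂ρ := by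
  rw [integral_sub Integrable.of_finite Integrable.of_finite, integral_const_mul,
    M.integral_occupancy_eq σ ρ u]
  ring

end MDP

variable {d : ℕ} {U : EuclideanSpace ℝ (Fin d) → ℝ}
  {M : MDP S (EuclideanSpace ℝ (Fin d))} {τ : ℝ}
  {π : ℝ → Kernel S (EuclideanSpace ℝ (Fin d))} [∀ t, IsMarkovKernel (π t)]
  {p : ℝ → S → EuclideanSpace ℝ (Fin d) → ℝ}

omit [Fintype S] [MeasurableSingletonClass S] in
lemma LogSobolevAlongFlow.mono {μ : Measure (EuclideanSpace ℝ (Fin d))} {α β : ℝ} (hβ : 0 < β)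
    (hβα : β ≤ α) (h : LogSobolevAlongFlow M τ μ π α) : LogSobolevAlongFlow M τ μ π β := by
  intro t ht s m hm g hg hpos heq
  refine (h t ht s m hm g hg hpos heq).trans ?_
  gcongr

/-- The gap to an optimal policy, averaged over its occupancy measure, decays exponentially: by the
log-Sobolev inequality its time derivative is at most `-2 α τ (1 - γ) ∫ (V^{π_t} - V^*) dρ`. -/
lemma IsRegularFlow.integral_gap_le (hflow : IsRegularFlow M τ U π p) (hU : Differentiable ℝ U)
    (hμ : IsProbabilityMeasure (refMeasure U)) (hτ : 0 < τ) {α : ℝ} (hα : 0 < α)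
    (hLS : LogSobolevAlongFlow M τ (refMeasure U) π α) (ρ : Measure S) [IsProbabilityMeasure ρ]
    (πs : Kernel S (EuclideanSpace ℝ (Fin d))) [IsMarkovKernel πs]
    (hopt : M.IsOptimal τ (refMeasure U) (Policy.ofKernel πs)) {t : ℝ} (ht : 0 ≤ t) :
    ∫ s, (M.value τ (refMeasure U) (π t) s - M.value τ (refMeasure U) πs s)
      ∂(M.occupancy πs ρ) ≤
    (∫ s, (M.value τ (refMeasure U) (π 0) s - M.value τ (refMeasure U) πs s)
      ∂(M.occupancy πs ρ)) *
      Real.exp (-(2 * M.kappaInf πs ρ * ((1 - M.γ) * α) * τ * t)) := by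
  have hkl := fun t (ht : 0 ≤ t) s => hflow.klDiv_ne_top hU.continuous hμ (t := t) ht s
  have hgap := fun t (ht : 0 ≤ t) =>
    MDP.IsOptimal.value_le M hτ (refMeasure U) hopt (π t) (hkl t ht)
  have hlim : Tendsto (fun t => ∫ s, (M.value τ (refMeasure U) (π t) s -
      M.value τ (refMeasure U) πs s) ∂(M.occupancy πs ρ)) (𝓝[>] 0)
      (𝓝 (∫ s, (M.value τ (refMeasure U) (π 0) s -
        M.value τ (refMeasure U) πs s) ∂(M.occupancy πs ρ))) := by
    simp_rw [integral_fintype Integrable.of_finite]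
    exact tendsto_finsetSum _ fun s _ =>
      ((hflow.tendsto_value_zero hU hμ hτ.le s).sub_const _).const_smul _
  have hder : ∀ t, 0 < t → ∃ w, HasDerivAt (fun t => ∫ s, (M.value τ (refMeasure U) (π t) s -
      M.value τ (refMeasure U) πs s) ∂(M.occupancy πs ρ)) w t ∧
      w ≤ -(2 * M.kappaInf πs ρ * ((1 - M.γ) * α) * τ *
        ∫ s, (M.value τ (refMeasure U) (π t) s - M.value τ (refMeasure U) πs s)
          ∂(M.occupancy πs ρ)) := fun t ht => by
    obtain ⟨w, hw⟩ := hflow.exists_hasDerivAt_value hU hμ hτ.le ht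
    refine ⟨∫ s, w s ∂(M.occupancy πs ρ), ?_, ?_⟩
    · simp_rw [integral_fintype Integrable.of_finite]
      exact HasDerivAt.fun_sum fun s _ => ((hw s).1.sub_const _).fun_const_smul _
    · set u : S → ℝ := fun s => M.value τ (refMeasure U) (π t) s -
        M.value τ (refMeasure U) πs s with hu
      have hpt : ∀ s, w s ≤
          -(2 * α * τ) * (u s - M.γ * ∫ x, u x ∂(M.stateKernel πs s)) := fun s => by
        have h1 := M.value_sub_le hτ (refMeasure U) (π t) πs (hkl t ht.le) (hgap t ht.le).1 s
        have h2 := hflow.klDiv_proximal_le hU hμ hτ hα hLS ht s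
        have h3 := M.value_eq_stageCost_add hτ.le (refMeasure U) πs (hgap t ht.le).1 s
        have h4 : u s - M.γ * ∫ x, u x ∂(M.stateKernel πs s) =
            M.value τ (refMeasure U) (π t) s - (M.stageCost τ (refMeasure U) πs s +
              M.γ * ∫ x, M.value τ (refMeasure U) (π t) x ∂(M.stateKernel πs s)) := by
          rw [hu, integral_sub Integrable.of_finite Integrable.of_finite]
          linarith
        have h5 := mul_le_mul_of_nonneg_left h1 (by positivity : 0 ≤ 2 * α * τ)
        rw [h4]
        linarith [(hw s).2]
      have hint : ∫ s, w s ∂(M.occupancy πs ρ) ≤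
          -(2 * α * τ) * ((1 - M.γ) * ∫ s, u s ∂ρ) := by
        rw [← M.integral_occupancy_sub πs ρ u, ← integral_const_mul]
        exact integral_mono Integrable.of_finite Integrable.of_finite hpt
      have hκ := (M.kappa_bounds πs ρ (f := u) fun s => sub_nonneg.2 ((hgap t ht.le).2 s)).1
      have hpos : 0 ≤ 2 * α * τ * (1 - M.γ) :=
        mul_nonneg (by positivity) (sub_nonneg.2 M.γ_lt_one.le)
      have := mul_le_mul_of_nonneg_left hκ hpos
      linarith
  exact le_mul_exp_of_deriv_le (c := 2 * M.kappaInf πs ρ * ((1 - M.γ) * α) * τ) hlim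
    (G' := deriv fun t => ∫ s, (M.value τ (refMeasure U) (π t) s -
      M.value τ (refMeasure U) πs s) ∂(M.occupancy πs ρ))
    (fun t ht => by
      obtain ⟨w, hw, -⟩ := hder t ht
      exact hw.differentiableAt.hasDerivAt)
    (fun t ht => by
      obtain ⟨w, hw, hle⟩ := hder t ht
      rw [hw.deriv]
      exact hle) ht

lemma IsRegularFlow.integral_value_sub_le (hflow : IsRegularFlow M τ U π p)
    (hU : Differentiable ℝ U) (hμ : IsProbabilityMeasure (refMeasure U)) (hτ : 0 < τ) {α : ℝ}
    (hα : 0 < α) (hLS : LogSobolevAlongFlow M τ (refMeasure U) π α) (ρ : Measure S)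
    [IsProbabilityMeasure ρ] (πs : Kernel S (EuclideanSpace ℝ (Fin d))) [IsMarkovKernel πs]
    (hopt : M.IsOptimal τ (refMeasure U) (Policy.ofKernel πs)) {t : ℝ} (ht : 0 ≤ t) :
    (∫ s, M.value τ (refMeasure U) (π t) s ∂ρ) - ∫ s, M.value τ (refMeasure U) πs s ∂ρ ≤
      M.kappaSup πs ρ *
        (∫ s, (M.value τ (refMeasure U) (π 0) s - M.value τ (refMeasure U) πs s)
          ∂(M.occupancy πs ρ)) *
        Real.exp (-(2 * M.kappaInf πs ρ * ((1 - M.γ) * α) * τ * t)) := by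
  obtain ⟨-, hgap⟩ := MDP.IsOptimal.value_le M hτ (refMeasure U) hopt (π t)
    fun s => hflow.klDiv_ne_top hU.continuous hμ ht s
  rw [← integral_sub Integrable.of_finite Integrable.of_finite, mul_assoc]
  exact (M.kappa_bounds πs ρ fun s => sub_nonneg.2 (hgap s)).2.trans
    (mul_le_mul_of_nonneg_left (hflow.integral_gap_le hU hμ hτ hα hLS ρ πs hopt ht)
      ENNReal.toReal_nonneg)

end Convergence

theorem mainTheorem1 {S : Type*} [Fintype S] [MeasurableSpace S] [MeasurableSingletonClass S]
    (d : ℕ) (M : MDP S (EuclideanSpace ℝ (Fin d))) (τ : ℝ) (hτ : 0 < τ)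
    (U : EuclideanSpace ℝ (Fin d) → ℝ) (hU : Differentiable ℝ U)
    (hμ : IsProbabilityMeasure (refMeasure U))
    (hLSI : ∃ α₀ : ℝ, 0 < α₀ ∧ LogSobolev α₀ (refMeasure U))
    (π : ℝ → Kernel S (EuclideanSpace ℝ (Fin d))) [∀ t, IsMarkovKernel (π t)]
    (p : ℝ → S → EuclideanSpace ℝ (Fin d) → ℝ) (hflow : IsRegularFlow M τ U π p) :
    (∃ α : ℝ, 0 < α ∧ LogSobolevAlongFlow M τ (refMeasure U) π α ∧
      ∀ (ρ : Measure S) [IsProbabilityMeasure ρ]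
        (πs : Kernel S (EuclideanSpace ℝ (Fin d))) [IsMarkovKernel πs],
        M.IsOptimal τ (refMeasure U) (Policy.ofKernel πs) →
        ∀ t : ℝ, 0 ≤ t →
          0 ≤ (∫ s, M.value τ (refMeasure U) (π t) s ∂ρ) -
              ∫ s, M.value τ (refMeasure U) πs s ∂ρ ∧
          (∫ s, M.value τ (refMeasure U) (π t) s ∂ρ) -
              ∫ s, M.value τ (refMeasure U) πs s ∂ρ ≤
            M.kappaSup πs ρ *
              (∫ s, (M.value τ (refMeasure U) (π 0) s - M.value τ (refMeasure U) πs s)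
                ∂(M.occupancy πs ρ)) *
              Real.exp (-(2 * M.kappaInf πs ρ * α * τ * t))) ∧
    ∀ α : ℝ, 0 < α → LogSobolevAlongFlow M τ (refMeasure U) π α →
      ∀ (ρ : Measure S) [IsProbabilityMeasure ρ]
        (πs : Kernel S (EuclideanSpace ℝ (Fin d))) [IsMarkovKernel πs],
        M.IsOptimal τ (refMeasure U) (Policy.ofKernel πs) →
        ∀ t : ℝ, 0 ≤ t →
          (∫ s, M.value τ (refMeasure U) (π t) s ∂ρ) -
              ∫ s, M.value τ (refMeasure U) πs s ∂ρ ≤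
            M.kappaSup πs ρ *
              (∫ s, (M.value τ (refMeasure U) (π 0) s - M.value τ (refMeasure U) πs s)
                ∂(M.occupancy πs ρ)) *
              Real.exp (-(2 * M.kappaInf πs ρ * ((1 - M.γ) * α) * τ * t)) := by
  refine ⟨?_, fun α hα hLS ρ _ πs _ hopt t ht =>
    hflow.integral_value_sub_le hU hμ hτ hα hLS ρ πs hopt ht⟩
  obtain ⟨α, hα, hLS⟩ := hflow.exists_logSobolevAlongFlow hU hμ hτ hLSI
  have hα' : 0 < (1 - M.γ) * α := mul_pos (sub_pos.2 M.γ_lt_one) hα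
  have hle : (1 - M.γ) * α ≤ α :=
    mul_le_of_le_one_left hα.le (sub_le_self 1 M.γ_nonneg)
  -- a smaller constant is still admissible in the log-Sobolev inequality, so that the factor
  -- `1 - γ` of the rate can be absorbed
  refine ⟨(1 - M.γ) * α, hα', hLS.mono hα' hle, fun ρ _ πs _ hopt t ht => ⟨?_,
    hflow.integral_value_sub_le hU hμ hτ hα hLS ρ πs hopt ht⟩⟩
  obtain ⟨-, hgap⟩ := MDP.IsOptimal.value_le M hτ (refMeasure U) hopt (π t)
    fun s => hflow.klDiv_ne_top hU.continuous hμ ht s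
  exact sub_nonneg.2 (integral_mono Integrable.of_finite Integrable.of_finite hgap)
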